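/- Let $H$ be a separable complex Hilbert space. For a compact operator $T$ on $H$ let $\lambda(T)=(\lambda_k(T))_{k\ge1}$ be the sequence of its non-zero eigenvalues, counted with algebraic multiplicity and ordered by decreasing modulus, continued by zeros if there are only finitely many (equality of two such sequences is understood up to the order of eigenvalues of equal modulus), and let $s_k(T)=\sqrt{\lambda_k(T^*T)}$ be its singular values. A weight is a non-increasing sequence $w=(w_k)_{k\ge1}$ of non-negative reals with $w_k\to0$. For a weight $w$, $E_w(H)$ is the set of compact operators $T$ on $H$ for which there is $M\ge0$ with $s_k(T)\le M w_k$ for all $k\ge1$; the infimum of all such $M$ is denoted by $|T|_w$. Put $\bar w_k=(w_1\cdots w_k)^{1/k}$ and $\dot w=(w_1,w_1,w_2,w_2,\ldots)$, so that $\dot{\bar w}=(w_1,w_1,(w_1w_2)^{1/2},(w_1w_2)^{1/2},\ldots)$. An operator is quasi-nilpotent if its spectrum contains no non-zero point. A Schur decomposition of a compact operator $A$ is a decomposition $A=D+N$ with $D,N$ compact, $D$ normal, $\lambda(D)=\lambda(A)$, and $N$ as well as $(zI-D)^{-1}N$ quasi-nilpotent for every $z$ in the resolvent set of $D$ (which equals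 that of $A$). For $A\in E_w(H)$, let $\nu_w(A)$ be the infimum of $|N|_{\dot{\bar w}}$ over all Schur decompositions $A=D+N$. **Proposition.** Let $w$ be a weight and $A\in E_w(H)$. If $A=D+N$ is any Schur decomposition of $A$, then (i) $D\in E_{\bar w}(H)$ and $|D|_{\bar w}\le|A|_w$; (ii) $N\in E_{\dot{\bar w}}(H)$ and $|N|_{\dot{\bar w}}\le2|A|_w$. Moreover, $A$ has a Schur decomposition, so that $\nu_w(A)$ is an infimum over a non-empty set, and $\nu_w(A)\le2|A|_w$. -/

import Mathlib

open scoped InnerProductSpace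

noncomputable section

/-! Sequences are indexed from `0`: the term with index `k` is the `(k+1)`-st term of the
mathematical sequence. -/

/-- Weight sequences: non-negative, non-increasing real sequences tending to `0`. -/
structure IsWeight (w : ℕ → ℝ) : Prop where
  nonneg : ∀ k, 0 ≤ w k
  antitone : Antitone w
  tendsto_zero : Filter.Tendsto w Filter.atTop (nhds 0)

/-- The sequence `w̄` of successive geometric means, `(w₁ ⋯ w_k)^(1/k)`. -/
def geomMeans (w : ℕ → ℝ) (k : ℕ) : ℝ :=
  (∏ i ∈ Finset.range (k + 1), w i) ^ (1 / ((k : ℝ) + 1))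

/-- The sequence `ẇ = (w₁, w₁, w₂, w₂, w₃, w₃, …)`. -/
def doubled (w : ℕ → ℝ) (k : ℕ) : ℝ := w (k / 2)

section Operators

variable {H H₁ H₂ : Type*}
  [NormedAddCommGroup H] [InnerProductSpace ℂ H]
  [NormedAddCommGroup H₁] [InnerProductSpace ℂ H₁] [CompleteSpace H₁]
  [NormedAddCommGroup H₂] [InnerProductSpace ℂ H₂] [CompleteSpace H₂]

/-- The algebraic multiplicity of `z` as an eigenvalue of `T`: the dimension of
`⋃ n, ker (T - z) ^ n`. It is finite when `T` is compact and `z ≠ 0`. -/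
def algMultiplicity (T : H →L[ℂ] H) (z : ℂ) : ℕ :=
  Module.finrank ℂ (Module.End.maxGenEigenspace (T : Module.End ℂ H) z)

/-- `l` lists the non-zero eigenvalues of `T` by decreasing modulus, each as often as its
algebraic multiplicity says, and is filled up with zeros if there are only finitely many.
(As the moduli decrease, a zero can only be followed by zeros. The equality in `ℕ∞` says in
particular that no non-zero value is taken infinitely often.) -/
def IsEigenvalueSeq (T : H →L[ℂ] H) (l : ℕ → ℂ) : Prop :=
  Antitone (fun k => ‖l k‖) ∧
    ∀ z : ℂ, z ≠ 0 → {k : ℕ | l k = z}.encard = (algMultiplicity T z : ℕ∞)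

open Classical in
/-- The eigenvalue sequence `λ(T)` of a compact operator `T`. Every compact operator has one. It
is determined up to the order of eigenvalues of equal modulus. That order is chosen, and the
choice depends only on the non-zero eigenvalues and their multiplicities, so for compact operators
`λ(S) = λ(T)` means that these data agree. -/
def eigenvalueSeq (T : H →L[ℂ] H) : ℕ → ℂ :=
  if h : ∃ l : ℕ → ℂ, IsEigenvalueSeq T l then h.choose else 0

/-- The singular values of a compact operator `A`: the square roots of the eigenvalues of
`A* A` (which are real and non-negative). -/
def singularValue (A : H₁ →L[ℂ] H₂) (k : ℕ) : ℝ :=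
  Real.sqrt (eigenvalueSeq (A.adjoint ∘L A) k).re

/-- The set `E_w(H₁, H₂)` of `w`-compact operators. -/
def compactnessClass (w : ℕ → ℝ) : Set (H₁ →L[ℂ] H₂) :=
  {A | IsCompactOperator A ∧ ∃ M : ℝ, 0 ≤ M ∧ ∀ k, singularValue A k ≤ M * w k}

/-- The `w`-gauge `|A|_w` of a `w`-compact operator `A`. -/
def gauge_w (w : ℕ → ℝ) (A : H₁ →L[ℂ] H₂) : ℝ :=
  sInf {M : ℝ | 0 ≤ M ∧ ∀ k, singularValue A k ≤ M * w k}

/-- Quasi-nilpotent operators: the spectrum consists of the point `0` only. (Inclusion is the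
same as equality, except on the zero space, where every spectrum is empty.) -/
def IsQuasinilpotent (T : H →L[ℂ] H) : Prop := spectrum ℂ T ⊆ {0}

/-- `A = D + N` is a Schur decomposition of the compact operator `A` with normal part `D` and
quasi-nilpotent part `N`. (Equality of the eigenvalue sequences entails that `D` and `A` have
the same resolvent set.) -/
structure IsSchurDecomposition (A D N : H₁ →L[ℂ] H₁) : Prop where
  eq_add : A = D + N
  compact_normalPart : IsCompactOperator D
  compact_nilpotentPart : IsCompactOperator N
  normal : IsStarNormal D
  eigenvalueSeq_eq : eigenvalueSeq D = eigenvalueSeq A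
  quasinilpotent : IsQuasinilpotent N
  quasinilpotent_resolvent_mul :
    ∀ z ∈ resolventSet ℂ D, IsQuasinilpotent (resolvent D z * N)

/-- The `w`-departure from normality `ν_w(A)`: the infimum of the gauges of the quasi-nilpotent
parts of all Schur decompositions of `A`. -/
def departure (w : ℕ → ℝ) (A : H₁ →L[ℂ] H₁) : ℝ :=
  sInf {r : ℝ | ∃ D N : H₁ →L[ℂ] H₁,
    IsSchurDecomposition A D N ∧ r = gauge_w (doubled (geomMeans w)) N}

end Operators

end

/-! Let `M` satisfy `s_k(A) ≤ M w_k` for all `k`. Weyl's inequality bounds the product of the first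
`k + 1` eigenvalue moduli of `A` by the corresponding product of singular values. As the moduli
decrease, the `k`-th one is at most `M` times the geometric mean `geomMeans w k`. The normal part
`D` has the same eigenvalue sequence, and the singular values of a compact normal operator are
bounded by its eigenvalue moduli, which gives (i).

For (ii), singular values are approximation numbers, so `s_k(A - D) ≤ s_i(A) + s_j(D)` when `i + j ≤
k`. With `i = j = k / 2` both terms are at most `M * geomMeans w (k / 2)`, because a non-increasing
sequence lies below its geometric means. Hence the doubled sequence and the factor 2. The gauge
bounds follow by taking the infimum over `M`.

For existence, choose an orthonormal system `e` in which `A` is triangular with its eigenvalues on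
the diagonal and whose span contains all generalized eigenspaces for non-zero eigenvalues. Let `D`
be the diagonal operator and `N = A - D`. A left eigenvector of `N`, or of a resolvent of `D` times
`N`, with non-zero eigenvalue is orthogonal to every `e k` by strict triangularity. It is then a
left eigenvector of `A` orthogonal to the generalized eigenspaces, hence zero. The same triangular
systems carry Weyl's inequality and, for `A* A`, the singular value theory. -/

open scoped InnerProductSpace

/-! ### Riesz theory: generalized eigenspaces of compact operators. -/

section Riesz

variable {H : Type*} [NormedAddCommGroup H] [InnerProductSpace ℂ H]

/-- One step of an orthonormal triangularization. -/
theorem exists_unit_triangular_step (A : H →L[ℂ] H) (E : Submodule ℂ H) [FiniteDimensional ℂ E]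
    (hE : ∀ x ∈ E, A x ∈ E) (z : ℂ)
    (hz : ¬ Module.End.maxGenEigenspace (A : Module.End ℂ H) z ≤ E) :
    ∃ e : H, ‖e‖ = 1 ∧ (∀ x ∈ E, ⟪e, x⟫_ℂ = 0) ∧ A e - z • e ∈ E ∧
      ∃ v ∈ Module.End.maxGenEigenspace (A : Module.End ℂ H) z, v ∈ E ⊔ ℂ ∙ e ∧ v ∉ E := by
  classical
  set V := Module.End.maxGenEigenspace (A : Module.End ℂ H) z with hV
  obtain ⟨v₀, hv₀, hv₀E⟩ := SetLike.not_le_iff_exists.1 hz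
  set S : Module.End ℂ H := (A : Module.End ℂ H) - z • 1 with hS
  obtain ⟨n, hn⟩ := (Module.End.mem_maxGenEigenspace _ _ _).1 hv₀
  -- The last iterate of `v₀` under `A - z` outside `E` is mapped into `E` by `A - z`; `e` is its
  -- normalized component orthogonal to `E`.
  have hex : ∃ k : ℕ, (S ^ k) v₀ ∈ E := ⟨n, by rw [hn]; exact E.zero_mem⟩
  have hmem : ∀ k, (S ^ k) v₀ ∈ V := fun k => by
    refine (Module.End.mem_maxGenEigenspace _ _ _).2 ⟨n, ?_⟩
    rw [← Module.End.mul_apply, ← hS, ← pow_add, add_comm, pow_add, Module.End.mul_apply, hn,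
      map_zero]
  obtain ⟨k, hk⟩ : ∃ k, Nat.find hex = k + 1 := by
    refine Nat.exists_eq_succ_of_ne_zero fun h => hv₀E ?_
    simpa [h] using Nat.find_spec hex
  have hvE : (S ^ k) v₀ ∉ E := Nat.find_min hex (by omega)
  have hSv : A ((S ^ k) v₀) - z • ((S ^ k) v₀) ∈ E := by
    have := Nat.find_spec hex
    rw [hk, pow_succ', Module.End.mul_apply] at this
    simpa [hS] using this
  set v := (S ^ k) v₀
  set p := E.starProjection v
  have hp : p ∈ E := E.starProjection_apply_mem v
  have hu : v - p ≠ 0 := fun h => hvE (by rw [sub_eq_zero.1 h]; exact hp)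
  have hort : ∀ x ∈ E, ⟪v - p, x⟫_ℂ = 0 := fun x hx =>
    Submodule.inner_left_of_mem_orthogonal hx (E.sub_starProjection_mem_orthogonal v)
  refine ⟨((‖v - p‖ : ℂ)⁻¹) • (v - p), ?_, ?_, ?_, v, hmem k, ?_, hvE⟩
  · rw [norm_smul, norm_inv, Complex.norm_real, norm_norm, inv_mul_cancel₀ (norm_ne_zero_iff.2 hu)]
  · intro x hx
    rw [inner_smul_left, hort x hx, mul_zero]
  · have : A ((‖v - p‖ : ℂ)⁻¹ • (v - p)) - z • ((‖v - p‖ : ℂ)⁻¹ • (v - p))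
        = (‖v - p‖ : ℂ)⁻¹ • ((A v - z • v) - (A p - z • p)) := by
      rw [map_smul, map_sub]; module
    rw [this]
    exact E.smul_mem _ (E.sub_mem hSv (E.sub_mem (hE _ hp) (E.smul_mem _ hp)))
  · have h1 : v = p + (‖v - p‖ : ℂ) • ((‖v - p‖ : ℂ)⁻¹ • (v - p)) := by
      rw [smul_inv_smul₀ (by exact_mod_cast norm_ne_zero_iff.2 hu)]; abel
    have h2 := Submodule.add_mem_sup hp (Submodule.smul_mem _ (‖v - p‖ : ℂ)
      (Submodule.mem_span_singleton_self ((‖v - p‖ : ℂ)⁻¹ • (v - p))))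
    rwa [← h1] at h2

theorem sup_span_singleton_invariant (A : H →L[ℂ] H) {E : Submodule ℂ H}
    (hE : ∀ x ∈ E, A x ∈ E) {z : ℂ} {e : H} (he : A e - z • e ∈ E) :
    ∀ x ∈ E ⊔ ℂ ∙ e, A x ∈ E ⊔ ℂ ∙ e := by
  intro x hx
  obtain ⟨y, hy, w, hw, rfl⟩ := Submodule.mem_sup.1 hx
  obtain ⟨c, rfl⟩ := Submodule.mem_span_singleton.1 hw
  have : A (y + c • e) = (A y + c • (A e - z • e)) + (c * z) • e := by
    rw [map_add, map_smul]; module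
  rw [this]
  exact Submodule.add_mem_sup (E.add_mem (hE _ hy) (E.smul_mem _ he))
    (Submodule.smul_mem _ _ (Submodule.mem_span_singleton_self _))

/-- The generalized eigenspaces of a compact operator for eigenvalues bounded away from zero lie
in a common finite-dimensional space. -/
theorem IsCompactOperator.exists_finiteDimensional_maxGenEigenspace_le {A : H →L[ℂ] H}
    (hA : IsCompactOperator A) {ε : ℝ} (hε : 0 < ε) :
    ∃ E : Submodule ℂ H, FiniteDimensional ℂ E ∧
      ∀ z : ℂ, ε ≤ ‖z‖ → Module.End.maxGenEigenspace (A : Module.End ℂ H) z ≤ E := by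
  -- Otherwise invariant finite-dimensional spaces can be enlarged for ever, giving orthonormal
  -- vectors whose images under `A` have mutual distance at least `ε`, against compactness.
  by_contra! hcon
  let X := {E : Submodule ℂ H // FiniteDimensional ℂ E ∧ ∀ x ∈ E, A x ∈ E}
  have step : ∀ E : X, ∃ E' : X, ∃ e : H, ∃ z : ℂ, E.1 ≤ E'.1 ∧ e ∈ E'.1 ∧ ‖e‖ = 1 ∧
      (∀ x ∈ E.1, ⟪e, x⟫_ℂ = 0) ∧ A e - z • e ∈ E.1 ∧ ε ≤ ‖z‖ := by
    rintro ⟨E, hf, hE⟩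
    obtain ⟨z, hz, hzE⟩ := hcon E hf
    obtain ⟨e, he1, heE, hAe, -⟩ := exists_unit_triangular_step A E hE z hzE
    exact ⟨⟨E ⊔ ℂ ∙ e, inferInstance, sup_span_singleton_invariant A hE hAe⟩, e, z, le_sup_left,
      Submodule.mem_sup_right (Submodule.mem_span_singleton_self _), he1, heE, hAe, hz⟩
  choose nx e z h1 h2 h3 h4 h5 h6 using step
  let E : ℕ → X := fun n => nx^[n] ⟨⊥, inferInstance, by simp⟩
  have hsucc : ∀ n, E (n + 1) = nx (E n) := fun n => Function.iterate_succ_apply' _ _ _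
  have hmono : Monotone fun n => (E n).1 := monotone_nat_of_le_succ fun n => by
    rw [hsucc]; exact h1 _
  have hAe : ∀ {m n}, m < n → A (e (E m)) ∈ (E n).1 := fun {m n} h => by
    have h7 : e (E m) ∈ (E (m + 1)).1 := by rw [hsucc]; exact h2 _
    exact (E n).2.2 _ (hmono (Nat.succ_le_of_lt h) h7)
  have hsep : ∀ m n, m < n → ε ≤ ‖A (e (E n)) - A (e (E m))‖ := by
    intro m n h
    -- Pairing with the newer vector annihilates everything in the older invariant space, so only
    -- the diagonal entry survives.
    have hin : ⟪e (E n), A (e (E n)) - A (e (E m))⟫_ℂ = z (E n) := by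
      have h7 : A (e (E n)) - A (e (E m))
          = ((A (e (E n)) - z (E n) • e (E n)) - A (e (E m))) + z (E n) • e (E n) := by abel
      rw [h7, inner_add_right, h4 _ _ (Submodule.sub_mem _ (h5 _) (hAe h)), inner_smul_right,
        inner_self_eq_norm_sq_to_K, h3]
      simp
    calc ε ≤ ‖z (E n)‖ := h6 _
      _ = ‖⟪e (E n), A (e (E n)) - A (e (E m))⟫_ℂ‖ := by rw [hin]
      _ ≤ ‖e (E n)‖ * ‖A (e (E n)) - A (e (E m))‖ := norm_inner_le_norm _ _
      _ = _ := by rw [h3, one_mul]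
  obtain ⟨K, hK, hK'⟩ := hA.image_closedBall_subset_compact 1
  obtain ⟨y, -, ψ, hψ, hψy⟩ := hK.tendsto_subseq (x := fun n => A (e (E n)))
    (fun n => hK' ⟨e (E n), by simp [h3], rfl⟩)
  obtain ⟨N, hN⟩ := Metric.cauchySeq_iff'.1 hψy.cauchySeq ε hε
  have := hN (N + 1) (Nat.le_succ N)
  rw [dist_eq_norm] at this
  exact this.not_ge (hsep _ _ (hψ N.lt_succ_self))

theorem IsCompactOperator.finiteDimensional_maxGenEigenspace {A : H →L[ℂ] H}
    (hA : IsCompactOperator A) {z : ℂ} (hz : z ≠ 0) :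
    FiniteDimensional ℂ (Module.End.maxGenEigenspace (A : Module.End ℂ H) z) := by
  obtain ⟨E, hf, hE⟩ := hA.exists_finiteDimensional_maxGenEigenspace_le (norm_pos_iff.2 hz)
  exact Submodule.finiteDimensional_of_le (hE z le_rfl)

theorem IsCompactOperator.finite_algMultiplicity_ne_zero {A : H →L[ℂ] H}
    (hA : IsCompactOperator A) {ε : ℝ} (hε : 0 < ε) :
    {z : ℂ | ε ≤ ‖z‖ ∧ algMultiplicity A z ≠ 0}.Finite := by
  obtain ⟨E, hf, hE⟩ := hA.exists_finiteDimensional_maxGenEigenspace_le hε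
  set Z := {z : ℂ | ε ≤ ‖z‖ ∧ algMultiplicity A z ≠ 0}
  have hex : ∀ z : Z, ∃ v ∈ Module.End.maxGenEigenspace (A : Module.End ℂ H) z.1, v ≠ 0 :=
    fun z => by
      refine Submodule.exists_mem_ne_zero_of_ne_bot fun h => z.2.2 ?_
      rw [algMultiplicity, h, finrank_bot]
  choose v hv hv0 using hex
  have hind : LinearIndependent ℂ v :=
    ((Module.End.independent_maxGenEigenspace (A : Module.End ℂ H)).comp
      (f := fun z : Z => z.1) Subtype.val_injective).linearIndependent _ hv hv0
  have hind' : LinearIndependent ℂ (fun z => (⟨v z, hE _ z.2.1 (hv z)⟩ : E)) :=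
    LinearIndependent.of_comp E.subtype hind
  exact Set.finite_coe_iff.1 hind'.finite

end Riesz

/-! ### Existence and uniqueness properties of the eigenvalue sequence. -/

section EigenvalueSequences

/-- A family of norms tending to zero along the cofinite filter can be enumerated by decreasing
norm. -/
theorem exists_rank_of_finite {I : Type*} [Countable I] (g : I → ℝ)
    (hg : ∀ i, {j | g i ≤ g j}.Finite) :
    ∃ r : I → ℕ, Function.Injective r ∧ (∀ i j, r i ≤ r j → g j ≤ g i) ∧
      ∀ i k, k ≤ r i → ∃ j, r j = k := by
  classical
  obtain ⟨f, hf⟩ := Countable.exists_injective_nat I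
  -- Ties in `g` are broken by an injection into `ℕ`, giving a strict total order with finite
  -- initial segments; the rank counts predecessors.
  let lt : I → I → Prop := fun j i => g i < g j ∨ (g i = g j ∧ f j < f i)
  have hfin : ∀ i, {j | lt j i}.Finite := fun i => (hg i).subset fun j hj => by
    rcases hj with h | h
    · exact h.le
    · exact h.1.le
  have htrans : ∀ {a b c}, lt a b → lt b c → lt a c := by
    rintro a b c (h | ⟨h, h'⟩) (k | ⟨k, k'⟩)
    · exact Or.inl (k.trans h)
    · exact Or.inl (k ▸ h)
    · exact Or.inl (h ▸ k)
    · exact Or.inr ⟨k.trans h, h'.trans k'⟩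
  have htri : ∀ a b, lt a b ∨ a = b ∨ lt b a := by
    intro a b
    rcases lt_trichotomy (g b) (g a) with h | h | h
    · exact Or.inl (Or.inl h)
    · rcases lt_trichotomy (f a) (f b) with h' | h' | h'
      · exact Or.inl (Or.inr ⟨h, h'⟩)
      · exact Or.inr (Or.inl (hf h'))
      · exact Or.inr (Or.inr (Or.inr ⟨h.symm, h'⟩))
    · exact Or.inr (Or.inr (Or.inl h))
  have hirr : ∀ a, ¬ lt a a := by
    rintro a (h | h)
    · exact lt_irrefl _ h
    · exact lt_irrefl _ h.2
  let r : I → ℕ := fun i => (hfin i).toFinset.card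
  have hlt : ∀ {a b}, lt a b → r a < r b := by
    intro a b h
    refine Finset.card_lt_card (Finset.ssubset_iff_of_subset ?_ |>.2 ⟨a, ?_, ?_⟩)
    · intro c hc
      simp only [Set.Finite.mem_toFinset, Set.mem_ofPred_eq] at hc ⊢
      exact htrans hc h
    · simpa using h
    · simpa using hirr a
  have hinj : Function.Injective r := by
    intro a b h
    rcases htri a b with h' | h' | h'
    · exact absurd h (hlt h').ne
    · exact h'
    · exact absurd h (hlt h').ne'
  refine ⟨r, hinj, fun i j hij => ?_, fun i k hk => ?_⟩
  · rcases htri i j with (h | h) | h | h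
    · exact h.le
    · exact h.1.le
    · rw [h]
    · exact absurd (hlt h) hij.not_gt
  · rcases hk.eq_or_lt with h | h
    · exact ⟨i, h.symm⟩
    -- The `r i` predecessors of `i` have distinct ranks below `r i`, so every smaller rank is
    -- attained.
    have hsub : (hfin i).toFinset.image r ⊆ Finset.range (r i) := by
      intro m hm
      obtain ⟨j, hj, rfl⟩ := Finset.mem_image.1 hm
      simp only [Set.Finite.mem_toFinset, Set.mem_ofPred_eq] at hj
      exact Finset.mem_range.2 (hlt hj)
    have heq := Finset.eq_of_subset_of_card_le hsub (by
      rw [Finset.card_range, Finset.card_image_of_injective _ hinj])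
    have : k ∈ (hfin i).toFinset.image r := by rw [heq]; exact Finset.mem_range.2 h
    obtain ⟨j, -, hj⟩ := Finset.mem_image.1 this
    exact ⟨j, hj⟩

/-- The sequence enumerates pairs (non-zero eigenvalue, copy number) by decreasing modulus; indices
that are no rank get the value 0. -/
theorem exists_seq_of_multiplicities (m : ℂ → ℕ)
    (hm : ∀ ε > 0, {z : ℂ | ε ≤ ‖z‖ ∧ m z ≠ 0}.Finite) :
    ∃ l : ℕ → ℂ, Antitone (fun k => ‖l k‖) ∧
      ∀ z : ℂ, z ≠ 0 → {k : ℕ | l k = z}.encard = (m z : ℕ∞) := by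
  classical
  let Z := {z : ℂ // z ≠ 0 ∧ m z ≠ 0}
  let I := Σ z : Z, Fin (m z.1)
  have hZ : Countable Z := by
    have : {z : ℂ | z ≠ 0 ∧ m z ≠ 0} ⊆ ⋃ n : ℕ, {z : ℂ | 1 / ((n : ℝ) + 1) ≤ ‖z‖ ∧ m z ≠ 0} := by
      intro z hz
      obtain ⟨n, hn⟩ := exists_nat_one_div_lt (norm_pos_iff.2 hz.1)
      exact Set.mem_iUnion.2 ⟨n, hn.le, hz.2⟩
    exact ((Set.countable_iUnion fun n => (hm _ (by positivity)).countable).mono this).to_subtype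
  have hfin : ∀ i : I, {j : I | ‖i.1.1‖ ≤ ‖j.1.1‖}.Finite := by
    intro i
    have hf : {z : Z | ‖i.1.1‖ ≤ ‖z.1‖}.Finite := by
      refine Set.Finite.of_finite_image ((hm ‖i.1.1‖ (norm_pos_iff.2 i.1.2.1)).subset ?_)
        (Subtype.val_injective.injOn)
      rintro _ ⟨z, hz, rfl⟩
      exact ⟨hz, z.2.2⟩
    have : {j : I | ‖i.1.1‖ ≤ ‖j.1.1‖} = Sigma.fst ⁻¹' {z : Z | ‖i.1.1‖ ≤ ‖z.1‖} := rfl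
    rw [this]
    refine Set.Finite.preimage' hf fun z _ => ?_
    refine (Set.finite_range (fun x : Fin (m z.1) => (⟨z, x⟩ : I))).subset ?_
    rintro ⟨z', x⟩ h
    obtain rfl : z' = z := h
    exact ⟨x, rfl⟩
  obtain ⟨r, hinj, hanti, hdown⟩ := exists_rank_of_finite (fun i : I => ‖i.1.1‖) hfin
  let l : ℕ → ℂ := fun k => if h : ∃ i, r i = k then h.choose.1.1 else 0
  have hl : ∀ i, l (r i) = i.1.1 := by
    intro i
    have h : ∃ j, r j = r i := ⟨i, rfl⟩
    have : l (r i) = h.choose.1.1 := dif_pos h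
    rw [this, hinj h.choose_spec]
  have hl0 : ∀ k, (¬ ∃ i, r i = k) → l k = 0 := fun k hk => dif_neg hk
  refine ⟨l, fun k k' hkk => ?_, fun z hz => ?_⟩
  · by_cases h : ∃ i, r i = k'
    · obtain ⟨i, rfl⟩ := h
      obtain ⟨j, rfl⟩ := hdown i k hkk
      simp only [hl]
      exact hanti _ _ hkk
    · simp only [hl0 _ h, norm_zero, norm_nonneg]
  · by_cases hmz : m z = 0
    · rw [hmz, Nat.cast_zero, Set.encard_eq_zero, Set.eq_empty_iff_forall_notMem]
      intro k hk
      by_cases h : ∃ i, r i = k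
      · obtain ⟨i, rfl⟩ := h
        have := i.1.2.2
        rw [← hl i, show l (r i) = z from hk] at this
        exact this hmz
      · exact hz ((show l k = z from hk).symm.trans (hl0 _ h))
    · have : {k : ℕ | l k = z} = Set.range fun x : Fin (m z) => r ⟨⟨z, hz, hmz⟩, x⟩ := by
        ext k
        constructor
        · intro hk
          by_cases h : ∃ i, r i = k
          · obtain ⟨⟨⟨z', hz'⟩, x⟩, rfl⟩ := h
            obtain rfl : z' = z := (hl _).symm.trans hk
            exact ⟨x, rfl⟩
          · exact absurd ((show l k = z from hk).symm.trans (hl0 _ h)) hz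
        · rintro ⟨x, rfl⟩
          exact hl _
      rw [this, ← Set.image_univ, Function.Injective.encard_image, Set.encard_univ]
      · simp
      · intro x y h
        exact eq_of_heq (Sigma.mk.inj (hinj h)).2

variable {H : Type*} [NormedAddCommGroup H] [InnerProductSpace ℂ H]

theorem IsCompactOperator.exists_isEigenvalueSeq {A : H →L[ℂ] H} (hA : IsCompactOperator A) :
    ∃ l, IsEigenvalueSeq A l :=
  exists_seq_of_multiplicities _ fun _ hε => hA.finite_algMultiplicity_ne_zero hε

theorem IsCompactOperator.isEigenvalueSeq_eigenvalueSeq {A : H →L[ℂ] H}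
    (hA : IsCompactOperator A) : IsEigenvalueSeq A (eigenvalueSeq A) := by
  rw [eigenvalueSeq, dif_pos hA.exists_isEigenvalueSeq]
  exact hA.exists_isEigenvalueSeq.choose_spec

/-- `IsEigenvalueSeq` sees the operator only through its multiplicities at non-zero points, so equal
multiplicities give the same predicate and thus the same chosen sequence. -/
theorem eigenvalueSeq_congr {S T : H →L[ℂ] H}
    (h : ∀ z ≠ 0, algMultiplicity S z = algMultiplicity T z) :
    eigenvalueSeq S = eigenvalueSeq T := by
  have : IsEigenvalueSeq S = IsEigenvalueSeq T := by
    funext l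
    simp only [IsEigenvalueSeq, eq_iff_iff, and_congr_right_iff]
    exact fun _ => forall₂_congr fun z hz => by rw [h z hz]
  unfold eigenvalueSeq
  rw [this]

theorem IsEigenvalueSeq.finite_fiber {T : H →L[ℂ] H} {l : ℕ → ℂ} (hl : IsEigenvalueSeq T l)
    {z : ℂ} (hz : z ≠ 0) : {k | l k = z}.Finite :=
  Set.finite_of_encard_eq_coe (hl.2 z hz)

theorem IsEigenvalueSeq.tendsto_zero {T : H →L[ℂ] H} (hT : IsCompactOperator T) {l : ℕ → ℂ}
    (hl : IsEigenvalueSeq T l) : Filter.Tendsto (fun k => ‖l k‖) Filter.atTop (nhds 0) := by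
  rw [Metric.tendsto_atTop]
  intro ε hε
  have hfin : {k | ε ≤ ‖l k‖}.Finite := by
    refine Set.Finite.subset (Set.Finite.biUnion (hT.finite_algMultiplicity_ne_zero hε)
      (t := fun z => {k | l k = z ∧ z ≠ 0}) fun z _ => ?_) fun k hk => ?_
    · by_cases hz : z = 0
      · simp [hz]
      · exact (hl.finite_fiber hz).subset fun k hk => hk.1
    · have h0 : l k ≠ 0 := norm_pos_iff.1 (hε.trans_le hk)
      refine Set.mem_biUnion (x := l k) ⟨hk, fun h => ?_⟩ ⟨rfl, h0⟩
      have := hl.2 (l k) h0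
      rw [h, Nat.cast_zero, Set.encard_eq_zero, Set.eq_empty_iff_forall_notMem] at this
      exact this k rfl
  obtain ⟨N, hN⟩ := hfin.bddAbove
  refine ⟨N + 1, fun n hn => ?_⟩
  rw [Real.dist_eq, sub_zero, abs_norm]
  by_contra! h
  have := hN h
  omega

end EigenvalueSequences

/-! ### Orthonormal triangularization along the eigenvalue sequence. -/

section TriangularSystems

variable {H : Type*} [NormedAddCommGroup H] [InnerProductSpace ℂ H]

/-- `e` is an orthogonal system triangularizing `A` on the span of its generalized eigenspaces for
non-zero eigenvalues, with diagonal `l`. The vectors are normalized, except that `e k = 0` if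
`l k = 0`. -/
structure IsTriangularSystem (A : H →L[ℂ] H) (l : ℕ → ℂ) (e : ℕ → H) : Prop where
  norm_eq_one : ∀ k, l k ≠ 0 → ‖e k‖ = 1
  eq_zero : ∀ k, l k = 0 → e k = 0
  inner_eq_zero : ∀ j k, j ≠ k → ⟪e j, e k⟫_ℂ = 0
  sub_mem_span : ∀ k, A (e k) - l k • e k ∈ Submodule.span ℂ (e '' Set.Iio k)
  maxGenEigenspace_le : ∀ z ≠ 0,
    Module.End.maxGenEigenspace (A : Module.End ℂ H) z ≤ Submodule.span ℂ (Set.range e)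

theorem mem_of_mem_sup_span_singleton_of_inner_eq_zero {E : Submodule ℂ H} {e x : H}
    (he : e ≠ 0) (heE : ∀ y ∈ E, ⟪e, y⟫_ℂ = 0) (hx : x ∈ E ⊔ ℂ ∙ e) (h : ⟪e, x⟫_ℂ = 0) :
    x ∈ E := by
  obtain ⟨y, hy, w, hw, rfl⟩ := Submodule.mem_sup.1 hx
  obtain ⟨c, rfl⟩ := Submodule.mem_span_singleton.1 hw
  rw [inner_add_right, heE y hy, zero_add, inner_smul_right, mul_eq_zero] at h
  rcases h with h | h
  · simpa [h] using hy
  · exact absurd (inner_self_eq_zero.1 h) he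

/-- Modulo `E`, the operator acts on `E ⊔ ℂ ∙ e` as multiplication by `z`, and pairing with `e`
reads off the class modulo `E`. Consequently adjoining `e` can affect only the multiplicity at `z`.
-/
theorem inner_sub_smul_pow_apply {A : H →L[ℂ] H} {E : Submodule ℂ H} (hE : ∀ x ∈ E, A x ∈ E)
    {z : ℂ} {e : H} (heE : ∀ y ∈ E, ⟪e, y⟫_ℂ = 0) (hAe : A e - z • e ∈ E) (y : ℂ) (n : ℕ) :
    ∀ x ∈ E ⊔ ℂ ∙ e, ⟪e, (((A : Module.End ℂ H) - y • (1 : Module.End ℂ H)) ^ n) x⟫_ℂ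
      = (z - y) ^ n * ⟪e, x⟫_ℂ := by
  induction n with
  | zero => intro x _; simp
  | succ n ih =>
    intro x hx
    have h1 : ((A : Module.End ℂ H) - y • (1 : Module.End ℂ H)) x = A x - y • x := by simp
    have h2 : ⟪e, A x⟫_ℂ = z * ⟪e, x⟫_ℂ := by
      obtain ⟨u, hu, w, hw, rfl⟩ := Submodule.mem_sup.1 hx
      obtain ⟨c, rfl⟩ := Submodule.mem_span_singleton.1 hw
      have : A (u + c • e) = (A u + c • (A e - z • e)) + (z * c) • e := by
        rw [map_add, map_smul]; module
      rw [this, inner_add_right, heE _ (E.add_mem (hE _ hu) (E.smul_mem _ hAe)), inner_add_right,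
        heE _ hu, inner_smul_right, inner_smul_right]
      ring
    rw [pow_succ, Module.End.mul_apply, h1, ih _ (Submodule.sub_mem _
      (sup_span_singleton_invariant A hE hAe x hx) (Submodule.smul_mem _ _ hx)), inner_sub_right,
      h2, inner_smul_right]
    ring

theorem maxGenEigenspace_inf_sup_of_ne {A : H →L[ℂ] H} {E : Submodule ℂ H}
    (hE : ∀ x ∈ E, A x ∈ E) {z : ℂ} {e : H} (he : e ≠ 0) (heE : ∀ y ∈ E, ⟪e, y⟫_ℂ = 0)
    (hAe : A e - z • e ∈ E) {y : ℂ} (hy : y ≠ z) :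
    Module.End.maxGenEigenspace (A : Module.End ℂ H) y ⊓ (E ⊔ ℂ ∙ e)
      = Module.End.maxGenEigenspace (A : Module.End ℂ H) y ⊓ E := by
  refine le_antisymm (fun x hx => ⟨hx.1, ?_⟩) (inf_le_inf_left _ le_sup_left)
  obtain ⟨n, hn⟩ := (Module.End.mem_maxGenEigenspace _ _ _).1 hx.1
  have := inner_sub_smul_pow_apply hE heE hAe y n x hx.2
  rw [hn, inner_zero_right, eq_comm, mul_eq_zero] at this
  exact mem_of_mem_sup_span_singleton_of_inner_eq_zero he heE hx.2
    (this.resolve_left (pow_ne_zero _ (sub_ne_zero.2 hy.symm)))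

/-- On the larger intersection the functional `⟪e, ·⟫` has the smaller one as kernel, and it does
not vanish at `v`. -/
theorem finrank_maxGenEigenspace_inf_sup_self {A : H →L[ℂ] H} {E : Submodule ℂ H}
    [FiniteDimensional ℂ E] {z : ℂ} {e : H} (he : e ≠ 0)
    (heE : ∀ y ∈ E, ⟪e, y⟫_ℂ = 0)
    {v : H} (hv : v ∈ Module.End.maxGenEigenspace (A : Module.End ℂ H) z) (hvE' : v ∈ E ⊔ ℂ ∙ e)
    (hvE : v ∉ E) :
    Module.finrank ℂ ↥(Module.End.maxGenEigenspace (A : Module.End ℂ H) z ⊓ (E ⊔ ℂ ∙ e))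
      = Module.finrank ℂ ↥(Module.End.maxGenEigenspace (A : Module.End ℂ H) z ⊓ E) + 1 := by
  set V := Module.End.maxGenEigenspace (A : Module.End ℂ H) z
  have hev : ⟪e, v⟫_ℂ ≠ 0 := fun h =>
    hvE (mem_of_mem_sup_span_singleton_of_inner_eq_zero he heE hvE' h)
  have hv0 : v ≠ 0 := by rintro rfl; exact hvE E.zero_mem
  have hfin : FiniteDimensional ℂ ↥(V ⊓ (E ⊔ ℂ ∙ e)) :=
    Submodule.finiteDimensional_of_le inf_le_right
  have hfin' : FiniteDimensional ℂ ↥(V ⊓ E) := Submodule.finiteDimensional_of_le inf_le_right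
  refine le_antisymm ?_ (Nat.succ_le_of_lt (Submodule.finrank_lt_finrank_of_lt
    (lt_of_le_of_ne (inf_le_inf_left _ le_sup_left) fun h => hvE ?_)))
  · have hle : V ⊓ (E ⊔ ℂ ∙ e) ≤ (V ⊓ E) ⊔ ℂ ∙ v := by
      intro x hx
      have h1 : x - (⟪e, x⟫_ℂ / ⟪e, v⟫_ℂ) • v ∈ V ⊓ E := by
        refine ⟨V.sub_mem hx.1 (V.smul_mem _ hv), ?_⟩
        refine mem_of_mem_sup_span_singleton_of_inner_eq_zero he heE
          (Submodule.sub_mem _ hx.2 (Submodule.smul_mem _ _ hvE')) ?_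
        rw [inner_sub_right, inner_smul_right, div_mul_cancel₀ _ hev, sub_self]
      have := Submodule.add_mem_sup h1 (Submodule.smul_mem _ (⟪e, x⟫_ℂ / ⟪e, v⟫_ℂ)
        (Submodule.mem_span_singleton_self v))
      rwa [sub_add_cancel] at this
    calc _ ≤ Module.finrank ℂ ↥((V ⊓ E) ⊔ ℂ ∙ v) := Submodule.finrank_mono hle
      _ ≤ Module.finrank ℂ ↥(V ⊓ E) + Module.finrank ℂ ↥(ℂ ∙ v) :=
        Submodule.finrank_add_le_finrank_add_finrank _ _
      _ ≤ _ := Nat.add_le_add_left (finrank_span_singleton hv0).le _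
  · have : v ∈ V ⊓ E := by rw [h]; exact ⟨hv, hvE'⟩
    exact this.2

theorem IsEigenvalueSeq.exists_triangular_step {A : H →L[ℂ] H} {l : ℕ → ℂ}
    (hl : IsEigenvalueSeq A l) (n : ℕ) (E : Submodule ℂ H) [FiniteDimensional ℂ E]
    (hE : ∀ x ∈ E, A x ∈ E)
    (hcard : ∀ z ≠ 0, Module.finrank ℂ
      ↥(Module.End.maxGenEigenspace (A : Module.End ℂ H) z ⊓ E)
        = ((Finset.range n).filter fun i => l i = z).card) :
    ∃ e : H, (l n ≠ 0 → ‖e‖ = 1) ∧ (l n = 0 → e = 0) ∧ (∀ x ∈ E, ⟪e, x⟫_ℂ = 0) ∧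
      A e - l n • e ∈ E ∧ ∀ z ≠ 0, Module.finrank ℂ
        ↥(Module.End.maxGenEigenspace (A : Module.End ℂ H) z ⊓ (E ⊔ ℂ ∙ e))
          = ((Finset.range (n + 1)).filter fun i => l i = z).card := by
  by_cases h0 : l n = 0
  · refine ⟨0, fun h => absurd h0 h, fun _ => rfl, by simp, by simp, fun z hz => ?_⟩
    rw [Finset.range_add_one, Finset.filter_insert, if_neg (by rw [h0]; exact hz.symm),
      ← hcard z hz, Submodule.span_zero_singleton, sup_bot_eq]
  -- If the whole generalized eigenspace lay in `E`, its dimension would count only indices below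
  -- `n`, while index `n` itself is one more.
  · have hz : ¬ Module.End.maxGenEigenspace (A : Module.End ℂ H) (l n) ≤ E := by
      intro hle
      have h1 := hcard _ h0
      rw [inf_eq_left.2 hle] at h1
      have h2 := hl.2 _ h0
      rw [algMultiplicity, h1] at h2
      have h3 : (((Finset.range (n + 1)).filter fun i => l i = l n : Finset ℕ) : Set ℕ)
          ⊆ {k | l k = l n} := fun k hk => by
        simpa using (Finset.mem_filter.1 hk).2
      have h4 := Set.encard_le_encard h3
      rw [h2, Set.encard_coe_eq_coe_finsetCard, Nat.cast_le, Finset.range_add_one,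
        Finset.filter_insert, if_pos rfl, Finset.card_insert_of_notMem (by simp)] at h4
      omega
    obtain ⟨e, he1, heE, hAe, v, hv, hvE', hvE⟩ := exists_unit_triangular_step A E hE _ hz
    have he : e ≠ 0 := norm_ne_zero_iff.1 (by rw [he1]; exact one_ne_zero)
    refine ⟨e, fun _ => he1, fun h => absurd h h0, heE, hAe, fun z hz => ?_⟩
    rw [Finset.range_add_one, Finset.filter_insert]
    split_ifs with h
    · subst h
      rw [finrank_maxGenEigenspace_inf_sup_self he heE hv hvE' hvE, hcard _ h0,
        Finset.card_insert_of_notMem (by simp)]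
    · rw [maxGenEigenspace_inf_sup_of_ne hE he heE hAe (Ne.symm h), hcard z hz]

theorem IsEigenvalueSeq.exists_isTriangularSystem {A : H →L[ℂ] H} (hA : IsCompactOperator A)
    {l : ℕ → ℂ} (hl : IsEigenvalueSeq A l) : ∃ e, IsTriangularSystem A l e := by
  classical
  -- The invariant of the recursion: the `n`-th space contains exactly as much of each generalized
  -- eigenspace as the first `n` entries of `l` prescribe.
  let X : ℕ → Type _ := fun n => {E : Submodule ℂ H // FiniteDimensional ℂ E ∧
    (∀ x ∈ E, A x ∈ E) ∧ ∀ z ≠ 0, Module.finrank ℂ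
      ↥(Module.End.maxGenEigenspace (A : Module.End ℂ H) z ⊓ E)
        = ((Finset.range n).filter fun i => l i = z).card}
  have step : ∀ n, ∀ E : X n, ∃ E' : X (n + 1), ∃ e : H, E'.1 = E.1 ⊔ ℂ ∙ e ∧
      (l n ≠ 0 → ‖e‖ = 1) ∧ (l n = 0 → e = 0) ∧ (∀ x ∈ E.1, ⟪e, x⟫_ℂ = 0) ∧
      A e - l n • e ∈ E.1 := by
    rintro n ⟨E, hf, hE, hc⟩
    obtain ⟨e, h1, h2, h3, h4, h5⟩ := hl.exists_triangular_step n E hE hc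
    exact ⟨⟨E ⊔ ℂ ∙ e, inferInstance, sup_span_singleton_invariant A hE h4, h5⟩, e, rfl, h1, h2,
      h3, h4⟩
  choose nx e' h1 h2 h3 h4 h5 using step
  let E : ∀ n, X n := fun n => Nat.rec ⟨⊥, inferInstance, by simp, by simp⟩ (fun n E => nx n E) n
  let e : ℕ → H := fun n => e' n (E n)
  have hspan : ∀ n, (E n).1 = Submodule.span ℂ (e '' Set.Iio n) := by
    intro n
    induction n with
    | zero =>
      change (⊥ : Submodule ℂ H) = _
      simp
    | succ n ih =>
      have : (E (n + 1)).1 = (E n).1 ⊔ ℂ ∙ e n := h1 n (E n)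
      rw [this, ih, sup_comm, ← Submodule.span_insert, ← Set.image_insert_eq]
      congr 2
      ext k
      simp only [Set.mem_insert_iff, Set.mem_Iio]
      omega
  have hlt : ∀ j k, j < k → ⟪e k, e j⟫_ℂ = 0 := fun j k h => by
    refine h4 k (E k) _ ?_
    rw [hspan]
    exact Submodule.subset_span ⟨j, h, rfl⟩
  refine ⟨e, fun k => h2 k (E k), fun k => h3 k (E k), fun j k hjk => ?_, fun k => ?_,
    fun z hz => ?_⟩
  · rcases hjk.lt_or_gt with h | h
    · rw [← inner_conj_symm, hlt _ _ h, map_zero]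
    · exact hlt _ _ h
  · rw [← hspan]; exact h5 k (E k)
  -- Past the last index where `l` takes the value `z`, the dimensions agree and the generalized
  -- eigenspace is absorbed.
  · have hfin := hl.finite_fiber hz
    obtain ⟨N, hN⟩ := hfin.bddAbove
    have hcard := (E (N + 1)).2.2.2 z hz
    have heq : (((Finset.range (N + 1)).filter fun i => l i = z : Finset ℕ) : Set ℕ)
        = {k | l k = z} := by
      ext k
      simp only [Finset.coe_filter, Finset.mem_range, Set.mem_ofPred_eq, and_iff_right_iff_imp]
      intro hk
      have : k ≤ N := hN hk
      omega
    have h6 := hl.2 z hz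
    rw [← heq, Set.encard_coe_eq_coe_finsetCard, Nat.cast_inj, ← hcard, algMultiplicity] at h6
    have := hA.finiteDimensional_maxGenEigenspace hz
    have h7 := Submodule.eq_of_le_of_finrank_eq inf_le_left h6
    rw [← h7]
    exact inf_le_right.trans
      ((hspan (N + 1)).le.trans (Submodule.span_mono (Set.image_subset_range _ _)))

theorem IsTriangularSystem.orthonormal {A : H →L[ℂ] H} {l : ℕ → ℂ} {e : ℕ → H}
    (he : IsTriangularSystem A l e) {n : ℕ}
    (hn : ∀ i < n, l i ≠ 0) : Orthonormal ℂ fun j : Fin n => e j :=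
  ⟨fun j => he.norm_eq_one _ (hn j j.2), fun _ _ hjk => he.inner_eq_zero _ _
    fun h => hjk (Fin.ext h)⟩

end TriangularSystems

/-! ### Finite diagonal operators on orthonormal systems padded with zeros. -/

section DiagonalOperators

variable {H : Type*} [NormedAddCommGroup H] [InnerProductSpace ℂ H]

/-- An orthogonal sequence of vectors each of which is zero or of norm one. -/
structure IsOrthonormalOrZero (e : ℕ → H) : Prop where
  eq_zero_or_norm : ∀ k, e k = 0 ∨ ‖e k‖ = 1
  inner_eq_zero : ∀ j k, j ≠ k → ⟪e j, e k⟫_ℂ = 0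

/-- The partial sum over `s` of the diagonal operator with entries `c` in the system `e`. -/
noncomputable def diagonalSum (c : ℕ → ℂ) (e : ℕ → H) (s : Finset ℕ) : H →L[ℂ] H :=
  ∑ k ∈ s, c k • InnerProductSpace.rankOne ℂ (e k) (e k)

theorem diagonalSum_apply (c : ℕ → ℂ) (e : ℕ → H) (s : Finset ℕ) (x : H) :
    diagonalSum c e s x = ∑ k ∈ s, (c k * ⟪e k, x⟫_ℂ) • e k := by
  simp [diagonalSum, smul_smul]

theorem IsTriangularSystem.isOrthonormalOrZero {A : H →L[ℂ] H} {l : ℕ → ℂ} {e : ℕ → H}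
    (he : IsTriangularSystem A l e) : IsOrthonormalOrZero e :=
  ⟨fun k => (em (l k = 0)).imp (he.eq_zero k) (he.norm_eq_one k), he.inner_eq_zero⟩

namespace IsOrthonormalOrZero

variable {e : ℕ → H} (he : IsOrthonormalOrZero e)
include he

theorem inner_self_mul (k : ℕ) (x : H) : ⟪e k, x⟫_ℂ * ⟪e k, e k⟫_ℂ = ⟪e k, x⟫_ℂ := by
  rcases he.eq_zero_or_norm k with h | h
  · simp [h]
  · simp [inner_self_eq_norm_sq_to_K, h]

theorem inner_diagonalSum (c : ℕ → ℂ) (s : Finset ℕ) (x : H) (j : ℕ) :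
    ⟪e j, diagonalSum c e s x⟫_ℂ = if j ∈ s then c j * ⟪e j, x⟫_ℂ else 0 := by
  rw [diagonalSum_apply, inner_sum]
  simp only [inner_smul_right]
  split_ifs with h
  · rw [Finset.sum_eq_single_of_mem j h fun k _ hk => by
      rw [he.inner_eq_zero j k hk.symm, mul_zero], mul_assoc, he.inner_self_mul]
  · exact Finset.sum_eq_zero fun k hk => by
      rw [he.inner_eq_zero j k (fun h' => h (h' ▸ hk)), mul_zero]

theorem norm_sq_diagonalSum (c : ℕ → ℂ) (s : Finset ℕ) (x : H) :
    ‖diagonalSum c e s x‖ ^ 2 = ∑ k ∈ s, ‖c k‖ ^ 2 * ‖⟪e k, x⟫_ℂ‖ ^ 2 := by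
  have : ((‖diagonalSum c e s x‖ ^ 2 : ℝ) : ℂ)
      = ((∑ k ∈ s, ‖c k‖ ^ 2 * ‖⟪e k, x⟫_ℂ‖ ^ 2 : ℝ) : ℂ) := by
    have h1 := inner_self_eq_norm_sq_to_K (𝕜 := ℂ) (diagonalSum c e s x)
    rw [diagonalSum_apply c e s x, sum_inner, ← diagonalSum_apply c e s x] at h1
    push_cast
    refine h1.symm.trans (Finset.sum_congr rfl fun k hk => ?_)
    rw [inner_smul_left, he.inner_diagonalSum, if_pos hk, mul_comm, Complex.mul_conj,
      Complex.normSq_eq_norm_sq, norm_mul]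
    push_cast
    ring
  exact_mod_cast this

/-- Bessel's inequality: expand `‖P x - x‖ ^ 2 ≥ 0` for `P = diagonalSum 1 e s`. -/
theorem sum_norm_inner_sq_le (s : Finset ℕ) (x : H) :
    ∑ k ∈ s, ‖⟪e k, x⟫_ℂ‖ ^ 2 ≤ ‖x‖ ^ 2 := by
  have h1 : ‖diagonalSum 1 e s x‖ ^ 2 = ∑ k ∈ s, ‖⟪e k, x⟫_ℂ‖ ^ 2 := by
    simp [he.norm_sq_diagonalSum]
  have h2 : RCLike.re ⟪diagonalSum 1 e s x, x⟫_ℂ = ∑ k ∈ s, ‖⟪e k, x⟫_ℂ‖ ^ 2 := by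
    rw [diagonalSum_apply, sum_inner, map_sum]
    refine Finset.sum_congr rfl fun k _ => ?_
    rw [inner_smul_left, Pi.one_apply, one_mul, mul_comm, Complex.mul_conj,
      Complex.normSq_eq_norm_sq]
    exact Complex.ofReal_re _
  have h3 := norm_sub_sq (𝕜 := ℂ) (diagonalSum 1 e s x) x
  rw [h2, h1] at h3
  nlinarith [sq_nonneg ‖diagonalSum 1 e s x - x‖]

theorem norm_diagonalSum_le {c : ℕ → ℂ} {s : Finset ℕ} {C : ℝ} (hC : 0 ≤ C)
    (hc : ∀ k ∈ s, ‖c k‖ ≤ C) : ‖diagonalSum c e s‖ ≤ C := by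
  refine ContinuousLinearMap.opNorm_le_bound _ hC fun x => ?_
  refine le_of_sq_le_sq ?_ (by positivity)
  rw [he.norm_sq_diagonalSum, mul_pow]
  calc ∑ k ∈ s, ‖c k‖ ^ 2 * ‖⟪e k, x⟫_ℂ‖ ^ 2 ≤ ∑ k ∈ s, C ^ 2 * ‖⟪e k, x⟫_ℂ‖ ^ 2 :=
        Finset.sum_le_sum fun k hk => by gcongr; exact hc k hk
    _ = C ^ 2 * ∑ k ∈ s, ‖⟪e k, x⟫_ℂ‖ ^ 2 := by rw [Finset.mul_sum]
    _ ≤ _ := by gcongr; exact he.sum_norm_inner_sq_le s x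

end IsOrthonormalOrZero

theorem rank_diagonalSum_le (c : ℕ → ℂ) (e : ℕ → H) (s : Finset ℕ) :
    (diagonalSum c e s : H →ₗ[ℂ] H).rank ≤ (s.card : Cardinal) := by
  classical
  have h : (diagonalSum c e s : H →ₗ[ℂ] H).range ≤ Submodule.span ℂ (s.image e : Set H) := by
    rintro _ ⟨x, rfl⟩
    rw [ContinuousLinearMap.coe_coe, diagonalSum_apply]
    exact Submodule.sum_mem _ fun k hk => Submodule.smul_mem _ _
      (Submodule.subset_span (by simpa using ⟨k, hk, rfl⟩))
  calc _ ≤ Module.rank ℂ (Submodule.span ℂ (s.image e : Set H)) := Submodule.rank_mono h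
    _ ≤ ((s.image e).card : Cardinal) := rank_span_finset_le _
    _ ≤ _ := by exact_mod_cast Finset.card_image_le

theorem isCompactOperator_of_rank_lt_aleph0 (F : H →L[ℂ] H)
    (h : (F : H →ₗ[ℂ] H).rank < Cardinal.aleph0) : IsCompactOperator F := by
  have : FiniteDimensional ℂ (F : H →ₗ[ℂ] H).range := Module.rank_lt_aleph0_iff.1 h
  have := FiniteDimensional.proper_rclike ℂ (F : H →ₗ[ℂ] H).range
  have hc : IsCompactOperator (F.codRestrict (F : H →ₗ[ℂ] H).range fun x => ⟨x, rfl⟩) :=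
    isCompactOperator_of_locallyCompactSpace_dom _
  exact hc.clm_comp (Submodule.subtypeL _)

variable [CompleteSpace H]

theorem adjoint_diagonalSum (c : ℕ → ℂ) (e : ℕ → H) (s : Finset ℕ) :
    (diagonalSum c e s).adjoint = diagonalSum (fun k => starRingEnd ℂ (c k)) e s := by
  simp [diagonalSum, map_sum, map_smulₛₗ]

theorem IsOrthonormalOrZero.isStarNormal_diagonalSum {e : ℕ → H} (he : IsOrthonormalOrZero e)
    (c : ℕ → ℂ) (s : Finset ℕ) : IsStarNormal (diagonalSum c e s) := by
  rw [ContinuousLinearMap.isStarNormal_iff_norm_eq_adjoint]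
  intro x
  rw [← sq_eq_sq₀ (norm_nonneg _) (norm_nonneg _), adjoint_diagonalSum, he.norm_sq_diagonalSum,
    he.norm_sq_diagonalSum]
  simp

end DiagonalOperators

/-! ### Spectral theory of compact normal operators. -/

section NormalCompact

variable {H : Type*} [NormedAddCommGroup H] [InnerProductSpace ℂ H] [CompleteSpace H]

theorem adjoint_apply_of_isStarNormal {T : H →L[ℂ] H} (hT : IsStarNormal T) {z : ℂ} {x : H}
    (hx : T x = z • x) : T.adjoint x = starRingEnd ℂ z • x := by
  have h : IsStarNormal (T - z • (1 : H →L[ℂ] H)) := by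
    refine ⟨?_⟩
    rw [star_sub, star_smul, star_one]
    exact (hT.star_comm_self.sub_right ((Commute.one_right _).smul_right z)).sub_left
      (((Commute.one_left _).smul_left _))
  have := (ContinuousLinearMap.IsStarNormal.adjoint_apply_eq_zero_iff h x).2 (by simp [hx])
  rw [map_sub, map_smulₛₗ] at this
  have h1 : ContinuousLinearMap.adjoint (1 : H →L[ℂ] H) = 1 := ContinuousLinearMap.adjoint_id
  rw [h1] at this
  simpa [sub_eq_zero] using this

theorem inner_apply_of_isStarNormal {T : H →L[ℂ] H} (hT : IsStarNormal T) {z : ℂ} {x : H}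
    (hx : T x = z • x) (y : H) : ⟪x, T y⟫_ℂ = z * ⟪x, y⟫_ℂ := by
  rw [← ContinuousLinearMap.adjoint_inner_left, adjoint_apply_of_isStarNormal hT hx,
    inner_smul_left, Complex.conj_conj]

/-- A triangular normal operator is diagonal: by induction the earlier vectors are eigenvectors of
the adjoint as well, so the off-diagonal part of `T (e k)` is orthogonal to the span in which it
lies. -/
theorem IsTriangularSystem.apply_of_isStarNormal {T : H →L[ℂ] H} (hT : IsStarNormal T)
    {l : ℕ → ℂ} {e : ℕ → H} (he : IsTriangularSystem T l e) (k : ℕ) : T (e k) = l k • e k := by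
  induction k using Nat.strong_induction_on with
  | _ k ih =>
    have h1 : ∀ y ∈ Submodule.span ℂ (e '' Set.Iio k), ⟪y, T (e k) - l k • e k⟫_ℂ = 0 := by
      intro y hy
      induction hy using Submodule.span_induction with
      | mem y hy =>
        obtain ⟨j, hj, rfl⟩ := hy
        rw [inner_sub_right, inner_apply_of_isStarNormal hT (ih j hj), inner_smul_right,
          he.inner_eq_zero j k (ne_of_lt hj)]
        simp
      | zero => simp
      | add x y _ _ hx hy => rw [inner_add_left, hx, hy, add_zero]
      | smul c x _ hx => rw [inner_smul_left, hx, mul_zero]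
    exact sub_eq_zero.1 (inner_self_eq_zero.1 (h1 _ (he.sub_mem_span k)))

/-- The norm of a compact normal operator is bounded by the moduli of its eigenvalues. -/
theorem norm_le_of_isStarNormal {T : H →L[ℂ] H} (hT : IsStarNormal T) (hc : IsCompactOperator T)
    {C : ℝ} (hC : 0 ≤ C) (h : ∀ (μ : ℂ) (x : H), μ ≠ 0 → x ≠ 0 → T x = μ • x → ‖μ‖ ≤ C) : ‖T‖ ≤ C := by
  rcases subsingleton_or_nontrivial H with hs | hs
  · have : T = 0 := by ext x; exact Subsingleton.elim _ _
    simpa [this] using hC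
  -- For a normal operator the norm is the spectral radius, attained at a spectral point; by
  -- compactness that point, if non-zero, is an eigenvalue.
  obtain ⟨μ, hμ, hr⟩ := spectrum.exists_nnnorm_eq_spectralRadius T
  rw [IsStarNormal.spectralRadius_eq_nnnorm] at hr
  have hn : ‖μ‖ = ‖T‖ := by
    have := ENNReal.coe_inj.1 hr
    exact congrArg NNReal.toReal this
  rw [← hn]
  by_cases h0 : μ = 0
  · simpa [h0] using hC
  · obtain ⟨x, hx⟩ := ((hc.hasEigenvalue_iff_mem_spectrum h0).2 hμ).exists_hasEigenvector
    exact h μ x h0 hx.2 hx.apply_eq_smul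

/-- The projection `P` onto the first `i` vectors commutes with `T` and its adjoint, so `T (1 - P)`
is compact and normal, and it suffices to bound its eigenvalues. -/
theorem IsTriangularSystem.norm_sub_comp_diagonalSum_le {T : H →L[ℂ] H} (hT : IsStarNormal T)
    (hc : IsCompactOperator T) {l : ℕ → ℂ} {e : ℕ → H} (he : IsTriangularSystem T l e)
    (hl : Antitone fun k => ‖l k‖) (i : ℕ) :
    ‖T ∘L (1 - diagonalSum 1 e (Finset.range i))‖ ≤ ‖l i‖ := by
  have heig := fun k => he.apply_of_isStarNormal hT k
  have ho := he.isOrthonormalOrZero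
  set P := diagonalSum 1 e (Finset.range i) with hP
  have hPT : ∀ x, P (T x) = T (P x) := fun x => by
    rw [hP, diagonalSum_apply, diagonalSum_apply, map_sum]
    refine Finset.sum_congr rfl fun k _ => ?_
    rw [map_smul, heig, inner_apply_of_isStarNormal hT (heig k), smul_smul]
    congr 1
    simp [mul_comm]
  have hPT' : ∀ x, P (T.adjoint x) = T.adjoint (P x) := fun x => by
    rw [hP, diagonalSum_apply, diagonalSum_apply, map_sum]
    refine Finset.sum_congr rfl fun k _ => ?_
    rw [map_smul, adjoint_apply_of_isStarNormal hT (heig k),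
      ContinuousLinearMap.adjoint_inner_right, heig, inner_smul_left, smul_smul]
    congr 1
    simp [mul_comm]
  have hPadj : P.adjoint = P := by
    rw [hP, adjoint_diagonalSum]
    congr 1
    ext k
    simp
  have hadj : (T ∘L (1 - P)).adjoint = T.adjoint ∘L (1 - P) := by
    rw [ContinuousLinearMap.adjoint_comp, map_sub, hPadj]
    have h1 : ContinuousLinearMap.adjoint (1 : H →L[ℂ] H) = 1 := ContinuousLinearMap.adjoint_id
    ext x
    simp [h1, hPT']
  have hn : IsStarNormal (T ∘L (1 - P)) := by
    rw [ContinuousLinearMap.isStarNormal_iff_norm_eq_adjoint]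
    intro x
    rw [hadj]
    exact ContinuousLinearMap.isStarNormal_iff_norm_eq_adjoint.1 hT _
  refine norm_le_of_isStarNormal hn (hc.comp_clm (1 - P)) (norm_nonneg _) fun μ x hμ hx hTx => ?_
  have hort : ∀ j < i, ⟪e j, x⟫_ℂ = 0 := by
    intro j hj
    have h1 : ⟪e j, (1 - P) x⟫_ℂ = 0 := by
      have : (1 - P) x = x - P x := rfl
      rw [this, inner_sub_right, hP, ho.inner_diagonalSum, if_pos (Finset.mem_range.2 hj)]
      simp
    have h2 : ⟪e j, T ((1 - P) x)⟫_ℂ = 0 := by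
      rw [inner_apply_of_isStarNormal hT (heig j), h1, mul_zero]
    have h3 : T ((1 - P) x) = μ • x := hTx
    rw [h3, inner_smul_right] at h2
    exact (mul_eq_zero.1 h2).resolve_left hμ
  have hPx : P x = 0 := by
    rw [hP, diagonalSum_apply]
    exact Finset.sum_eq_zero fun j hj => by simp [hort j (Finset.mem_range.1 hj)]
  have hTx' : T x = μ • x := by
    have h3 : T (x - P x) = μ • x := hTx
    rwa [hPx, sub_zero] at h3
  -- An eigenvalue `μ` larger than `‖l i‖` differs from all later `l j`, so `x` would be orthogonal
  -- to the whole system, whose span contains the eigenspace of `μ`.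
  by_contra! hlt
  have hall : ∀ j, ⟪e j, x⟫_ℂ = 0 := by
    intro j
    by_cases hj : j < i
    · exact hort j hj
    · have hne : l j ≠ μ := by
        rintro rfl
        exact absurd (hl (not_lt.1 hj)) hlt.not_ge
      have h1 := inner_apply_of_isStarNormal hT (heig j) x
      rw [hTx', inner_smul_right] at h1
      by_contra h0
      exact hne (mul_right_cancel₀ h0 h1).symm
  have hmem : x ∈ Submodule.span ℂ (Set.range e) := by
    refine he.maxGenEigenspace_le μ hμ (Module.End.eigenspace_le_maxGenEigenspace ?_)
    exact Module.End.mem_eigenspace_iff.2 hTx'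
  have h0 : ∀ y ∈ Submodule.span ℂ (Set.range e), ⟪y, x⟫_ℂ = 0 := by
    intro y hy
    induction hy using Submodule.span_induction with
    | mem y hy => obtain ⟨j, rfl⟩ := hy; exact hall j
    | zero => simp
    | add u v _ _ hu hv => rw [inner_add_left, hu, hv, add_zero]
    | smul c u _ hu => rw [inner_smul_left, hu, mul_zero]
  exact hx (inner_self_eq_zero.1 (h0 x hmem))

end NormalCompact

/-! ### Singular values as approximation numbers. -/

section SingularValues

theorem exists_ne_zero_apply_eq_zero_of_rank_le {H : Type*} [AddCommGroup H] [Module ℂ H] {i : ℕ}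
    (G : (Fin (i + 1) → ℂ) →ₗ[ℂ] H) (hG : G.rank ≤ (i : Cardinal)) : ∃ c, c ≠ 0 ∧ G c = 0 := by
  by_contra! h
  have h1 : G.ker = ⊥ := (Submodule.eq_bot_iff _).2 fun c hc => by
    by_contra h0
    exact h c h0 (LinearMap.mem_ker.1 hc)
  have h2 := G.finrank_range_add_finrank_ker
  rw [h1, finrank_bot, Module.finrank_fin_fun] at h2
  have h3 : Module.finrank ℂ G.range ≤ i := Module.finrank_le_of_rank_le hG
  omega

/-- The min-max half giving lower bounds for approximation errors: evaluate at a combination of `i +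
1` eigenvectors killed by an operator of rank at most `i`. -/
theorem Orthonormal.mul_norm_sq_le_re_inner {E ι : Type*} [NormedAddCommGroup E]
    [InnerProductSpace ℂ E] [Fintype ι] {u : ι → E} (hu : Orthonormal ℂ u) (T : E →ₗ[ℂ] E)
    {β : ι → ℝ} (hT : ∀ j, T (u j) = (β j : ℂ) • u j) {b : ℝ} (hb : ∀ j, b ≤ β j) (c : ι → ℂ) :
    b * ‖∑ j, c j • u j‖ ^ 2 ≤ RCLike.re ⟪∑ j, c j • u j, T (∑ j, c j • u j)⟫_ℂ := by
  have h1 : ⟪∑ j, c j • u j, T (∑ j, c j • u j)⟫_ℂ = ((∑ j, β j * ‖c j‖ ^ 2 : ℝ) : ℂ) := by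
    have h2 : T (∑ j, c j • u j) = ∑ j, ((β j : ℂ) * c j) • u j := by
      rw [map_sum]
      exact Finset.sum_congr rfl fun j _ => by rw [map_smul, hT, smul_smul, mul_comm]
    rw [h2, hu.inner_sum]
    push_cast
    refine Finset.sum_congr rfl fun j _ => ?_
    rw [mul_comm, mul_assoc, Complex.mul_conj, Complex.normSq_eq_norm_sq]
    push_cast; rfl
  have h3 : ‖∑ j, c j • u j‖ ^ 2 = ∑ j, ‖c j‖ ^ 2 := by
    have h4 := inner_self_eq_norm_sq_to_K (𝕜 := ℂ) (∑ j, c j • u j)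
    rw [hu.inner_sum] at h4
    have h5 : ((‖∑ j, c j • u j‖ ^ 2 : ℝ) : ℂ) = ((∑ j, ‖c j‖ ^ 2 : ℝ) : ℂ) := by
      push_cast
      refine h4.symm.trans (Finset.sum_congr rfl fun j _ => ?_)
      rw [mul_comm, Complex.mul_conj, Complex.normSq_eq_norm_sq]
      push_cast; rfl
    exact_mod_cast h5
  rw [h1, h3, Finset.mul_sum]
  refine (Finset.sum_le_sum fun j _ => ?_).trans (Complex.ofReal_re _).ge
  gcongr
  exact hb j

/-- An operator of rank at most `i` vanishes at a non-zero vector in the span of `i + 1`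
orthonormal vectors. -/
theorem Orthonormal.exists_sum_ne_zero_apply_eq_zero {E H : Type*} [NormedAddCommGroup E]
    [InnerProductSpace ℂ E] [AddCommGroup H] [Module ℂ H] {i : ℕ} {u : Fin (i + 1) → E}
    (hu : Orthonormal ℂ u) (G : E →ₗ[ℂ] H)
    (hG : (G ∘ₗ Fintype.linearCombination ℂ u).rank ≤ (i : Cardinal)) :
    ∃ c : Fin (i + 1) → ℂ, ∑ j, c j • u j ≠ 0 ∧ G (∑ j, c j • u j) = 0 := by
  obtain ⟨c, hc, hGc⟩ := exists_ne_zero_apply_eq_zero_of_rank_le _ hG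
  exact ⟨c, fun h => hc (funext (Fintype.linearIndependent_iff.1 hu.linearIndependent c h)), hGc⟩

variable {H : Type*} [NormedAddCommGroup H] [InnerProductSpace ℂ H] [CompleteSpace H]

theorem singularValue_nonneg (A : H →L[ℂ] H) (k : ℕ) : 0 ≤ singularValue A k :=
  Real.sqrt_nonneg _

theorem isStarNormal_adjoint_comp_self (A : H →L[ℂ] H) : IsStarNormal (A.adjoint ∘L A) :=
  (IsSelfAdjoint.star_mul_self A).isStarNormal

theorem IsCompactOperator.adjoint_comp_self {A : H →L[ℂ] H} (hA : IsCompactOperator A) :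
    IsCompactOperator (A.adjoint ∘L A) := hA.clm_comp A.adjoint

theorem inner_adjoint_comp_self_apply (A : H →L[ℂ] H) (x : H) :
    ⟪x, (A.adjoint ∘L A) x⟫_ℂ = (‖A x‖ : ℂ) ^ 2 := by
  rw [ContinuousLinearMap.comp_apply, ContinuousLinearMap.adjoint_inner_right,
    inner_self_eq_norm_sq_to_K]
  rfl

/-- The eigenvalue sequence of `A* A` with an orthonormal system of eigenvectors. -/
theorem IsCompactOperator.exists_isTriangularSystem_adjoint_comp_self {A : H →L[ℂ] H}
    (hA : IsCompactOperator A) : ∃ e : ℕ → H,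
      IsTriangularSystem (A.adjoint ∘L A) (eigenvalueSeq (A.adjoint ∘L A)) e ∧
      Antitone (singularValue A) ∧
      (∀ k, (singularValue A k : ℂ) ^ 2 = eigenvalueSeq (A.adjoint ∘L A) k) ∧
      ∀ k, (A.adjoint ∘L A) (e k) = ((singularValue A k : ℂ) ^ 2) • e k := by
  have hT : IsCompactOperator (A.adjoint ∘L A) := hA.adjoint_comp_self
  have hl := hT.isEigenvalueSeq_eigenvalueSeq
  obtain ⟨e, he⟩ := hl.exists_isTriangularSystem hT
  set l := eigenvalueSeq (A.adjoint ∘L A) with hldef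
  have heig := he.apply_of_isStarNormal (isStarNormal_adjoint_comp_self A)
  have hnn : ∀ k, ∃ r : ℝ, 0 ≤ r ∧ l k = r := by
    intro k
    by_cases h0 : l k = 0
    · exact ⟨0, le_rfl, by simpa using h0⟩
    · refine ⟨‖A (e k)‖ ^ 2, by positivity, ?_⟩
      have h1 := inner_adjoint_comp_self_apply A (e k)
      rw [heig, inner_smul_right, inner_self_eq_norm_sq_to_K, he.norm_eq_one k h0] at h1
      simpa using h1
  have hsq : ∀ k, (singularValue A k : ℂ) ^ 2 = l k := by
    intro k
    obtain ⟨r, hr, hlr⟩ := hnn k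
    have : singularValue A k = √r := by rw [singularValue, ← hldef, hlr, Complex.ofReal_re]
    rw [this, hlr]
    exact_mod_cast Real.sq_sqrt hr
  refine ⟨e, he, fun j k hjk => ?_, hsq, fun k => by rw [heig, hsq]⟩
  have h1 := hl.1 hjk
  simp only [← hsq, norm_pow, Complex.norm_real] at h1
  have h2 := (sq_le_sq₀ (norm_nonneg _) (norm_nonneg _)).1 h1
  rwa [Real.norm_of_nonneg (singularValue_nonneg A _),
    Real.norm_of_nonneg (singularValue_nonneg A _)] at h2

/-- Singular values bound approximation numbers from above. -/
theorem IsCompactOperator.exists_norm_sub_comp_le {A : H →L[ℂ] H} (hA : IsCompactOperator A)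
    (i : ℕ) : ∃ P : H →L[ℂ] H, (P : H →ₗ[ℂ] H).rank ≤ (i : Cardinal) ∧ P.adjoint = P ∧
      ‖A - A ∘L P‖ ≤ singularValue A i := by
  obtain ⟨e, he, -, hsq, -⟩ := hA.exists_isTriangularSystem_adjoint_comp_self
  have hT : IsCompactOperator (A.adjoint ∘L A) := hA.adjoint_comp_self
  have ho := he.isOrthonormalOrZero
  set P := diagonalSum 1 e (Finset.range i) with hP
  have hTP : ‖(A.adjoint ∘L A) ∘L (1 - P)‖ ≤ singularValue A i ^ 2 := by
    have := he.norm_sub_comp_diagonalSum_le (isStarNormal_adjoint_comp_self A) hT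
      hT.isEigenvalueSeq_eigenvalueSeq.1 i
    rw [← hsq, norm_pow, Complex.norm_real, Real.norm_of_nonneg (singularValue_nonneg A i)] at this
    exact this
  have hP1 : ∀ x, ‖(1 - P) x‖ ≤ ‖x‖ := by
    intro x
    have h1 : ⟪P x, (1 - P) x⟫_ℂ = 0 := by
      rw [hP, diagonalSum_apply, sum_inner]
      refine Finset.sum_eq_zero fun k hk => ?_
      have : (1 - P) x = x - P x := rfl
      rw [inner_smul_left, this, inner_sub_right, hP, ho.inner_diagonalSum, if_pos hk]
      simp
    have h2 := norm_add_sq_eq_norm_sq_add_norm_sq_of_inner_eq_zero (𝕜 := ℂ) _ _ h1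
    have h3 : P x + (1 - P) x = x := by simp
    rw [h3] at h2
    nlinarith [norm_nonneg x, norm_nonneg ((1 - P) x), norm_nonneg (P x)]
  refine ⟨P, (rank_diagonalSum_le _ _ _).trans (by rw [Finset.card_range]), ?_, ?_⟩
  · rw [hP, adjoint_diagonalSum]
    congr 1
    ext k
    simp
  · refine ContinuousLinearMap.opNorm_le_bound _ (singularValue_nonneg A i) fun x => ?_
    have h1 : (A - A ∘L P) x = A ((1 - P) x) := by simp
    rw [h1]
    refine le_of_sq_le_sq ?_ (mul_nonneg (singularValue_nonneg A i) (norm_nonneg _))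
    -- The bound for `A* A` on the complement of `P` is a squared bound for `A`, since `1 - P` is a
    -- contraction.
    have h2 : ‖A ((1 - P) x)‖ ^ 2
        = RCLike.re ⟪((A.adjoint ∘L A) ∘L (1 - P)) x, (1 - P) x⟫_ℂ :=
      A.apply_norm_sq_eq_inner_adjoint_left _
    calc ‖A ((1 - P) x)‖ ^ 2 ≤ ‖((A.adjoint ∘L A) ∘L (1 - P)) x‖ * ‖(1 - P) x‖ := by
          rw [h2]; exact re_inner_le_norm _ _
      _ ≤ (singularValue A i ^ 2 * ‖x‖) * ‖x‖ := by
          gcongr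
          · exact (ContinuousLinearMap.le_opNorm _ x).trans (by gcongr)
          · exact hP1 x
      _ = _ := by ring

theorem IsCompactOperator.exists_rank_le_norm_sub_le {A : H →L[ℂ] H} (hA : IsCompactOperator A)
    (i : ℕ) : ∃ F : H →L[ℂ] H, (F : H →ₗ[ℂ] H).rank ≤ (i : Cardinal) ∧
      ‖A - F‖ ≤ singularValue A i := by
  obtain ⟨P, hP, -, h⟩ := hA.exists_norm_sub_comp_le i
  exact ⟨A ∘L P, (LinearMap.rank_comp_le_right (P : H →ₗ[ℂ] H) (A : H →ₗ[ℂ] H)).trans hP, h⟩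

/-- Singular values bound approximation numbers from below. -/
theorem IsCompactOperator.singularValue_le_norm_sub {A F : H →L[ℂ] H} (hA : IsCompactOperator A)
    {i : ℕ} (hF : (F : H →ₗ[ℂ] H).rank ≤ (i : Cardinal)) :
    singularValue A i ≤ ‖A - F‖ := by
  obtain ⟨e, he, hanti, hsq, heig⟩ := hA.exists_isTriangularSystem_adjoint_comp_self
  rcases (singularValue_nonneg A i).eq_or_lt with h0 | h0
  · rw [← h0]; exact norm_nonneg _
  have hpos : ∀ j < i + 1, eigenvalueSeq (A.adjoint ∘L A) j ≠ 0 := fun j hj => by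
    rw [← hsq]
    have := h0.trans_le (hanti (Nat.lt_succ_iff.1 hj))
    exact pow_ne_zero _ (by exact_mod_cast this.ne')
  have ho := he.orthonormal hpos
  -- On this combination `x` of the top `i + 1` eigenvectors, `A` and `A - F` agree, while `‖A x‖`
  -- is at least the `i`-th singular value times `‖x‖`.
  obtain ⟨c, hc, hFc⟩ := ho.exists_sum_ne_zero_apply_eq_zero (F : H →ₗ[ℂ] H)
    ((LinearMap.rank_comp_le_left _ _).trans hF)
  have h1 := ho.mul_norm_sq_le_re_inner ((A.adjoint ∘L A : H →L[ℂ] H) : H →ₗ[ℂ] H)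
    (β := fun j => singularValue A j ^ 2) (b := singularValue A i ^ 2)
    (fun j => by
      rw [ContinuousLinearMap.coe_coe, heig]
      push_cast; rfl)
    (fun j => by gcongr; exact hanti (Nat.lt_succ_iff.1 j.2)) c
  set x := ∑ j : Fin (i + 1), c j • e j
  rw [ContinuousLinearMap.coe_coe, inner_adjoint_comp_self_apply, ← mul_pow] at h1
  have h2 : singularValue A i * ‖x‖ ≤ ‖A x‖ := by
    refine le_of_sq_le_sq (h1.trans (le_of_eq ?_)) (norm_nonneg _)
    rw [← Complex.ofReal_pow]
    exact Complex.ofReal_re _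
  have h3 : A x = (A - F) x := by
    have : F x = 0 := hFc
    rw [sub_apply, this, sub_zero]
  rw [h3] at h2
  exact le_of_mul_le_mul_right (h2.trans ((A - F).le_opNorm _)) (norm_pos_iff.2 hc)

theorem IsCompactOperator.tendsto_singularValue {A : H →L[ℂ] H} (hA : IsCompactOperator A) :
    Filter.Tendsto (singularValue A) Filter.atTop (nhds 0) := by
  have hT : IsCompactOperator (A.adjoint ∘L A) := hA.adjoint_comp_self
  have h1 := hT.isEigenvalueSeq_eigenvalueSeq.tendsto_zero hT
  have h2 := (Complex.continuous_re.tendsto 0).comp (tendsto_zero_iff_norm_tendsto_zero.2 h1)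
  have h3 := (Real.continuous_sqrt.tendsto _).comp h2
  rw [Complex.zero_re, Real.sqrt_zero] at h3
  exact h3

/-- Schauder's theorem in Hilbert spaces. -/
theorem IsCompactOperator.adjoint {A : H →L[ℂ] H} (hA : IsCompactOperator A) :
    IsCompactOperator A.adjoint := by
  choose P hP hPadj hAP using hA.exists_norm_sub_comp_le
  -- Taking adjoints turns the approximants `A ∘L P i` into finite-rank operators converging to the
  -- adjoint of `A`.
  have h1 : Filter.Tendsto (fun i => A ∘L P i) Filter.atTop (nhds A) := by
    rw [tendsto_iff_norm_sub_tendsto_zero]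
    refine squeeze_zero (fun _ => norm_nonneg _) (fun i => ?_) hA.tendsto_singularValue
    rw [norm_sub_rev]; exact hAP i
  have h2 : Filter.Tendsto (fun i => P i ∘L A.adjoint) Filter.atTop (nhds A.adjoint) := by
    have h3 := ((ContinuousLinearMap.adjoint (𝕜 := ℂ) (E := H) (F := H)).continuous.tendsto A).comp
      h1
    refine h3.congr fun i => ?_
    rw [Function.comp_apply, ContinuousLinearMap.adjoint_comp, hPadj]
  refine isCompactOperator_of_tendsto h2 (Filter.Eventually.of_forall fun i => ?_)
  exact isCompactOperator_of_rank_lt_aleph0 _ ((LinearMap.rank_comp_le_left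
    (A.adjoint : H →ₗ[ℂ] H) (P i : H →ₗ[ℂ] H)).trans_lt ((hP i).trans_lt Cardinal.natCast_lt_aleph0))

theorem singularValue_le_norm_of_isStarNormal {D : H →L[ℂ] H} (hD : IsStarNormal D)
    (hc : IsCompactOperator D) (i : ℕ) : singularValue D i ≤ ‖eigenvalueSeq D i‖ := by
  have hl := hc.isEigenvalueSeq_eigenvalueSeq
  obtain ⟨e, he⟩ := hl.exists_isTriangularSystem hc
  have h1 := he.norm_sub_comp_diagonalSum_le hD hc hl.1 i
  have h2 := hc.singularValue_le_norm_sub (F := D ∘L diagonalSum 1 e (Finset.range i)) (i := i)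
    ((LinearMap.rank_comp_le_right (diagonalSum 1 e (Finset.range i) : H →ₗ[ℂ] H)
      (D : H →ₗ[ℂ] H)).trans ((rank_diagonalSum_le _ _ _).trans (by rw [Finset.card_range])))
  have h3 : D - D ∘L diagonalSum 1 e (Finset.range i)
      = D ∘L (1 - diagonalSum 1 e (Finset.range i)) := by
    ext x; simp
  rw [h3] at h2
  exact h2.trans h1

end SingularValues

/-! ### Weyl's inequality. -/

section Weyl

variable {H : Type*} [NormedAddCommGroup H] [InnerProductSpace ℂ H] [CompleteSpace H]

/-- Weyl's inequality for determinants. -/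
theorem IsCompactOperator.norm_det_inner_le_prod_singularValue {A : H →L[ℂ] H}
    (hA : IsCompactOperator A) {n : ℕ} {v : Fin n → H} (hv : Orthonormal ℂ v) :
    ‖(Matrix.of fun i j => ⟪v i, A (v j)⟫_ℂ).det‖ ≤ ∏ i : Fin n, singularValue A i := by
  set M : Matrix (Fin n) (Fin n) ℂ := Matrix.of fun i j => ⟪v i, A (v j)⟫_ℂ with hM
  let b := EuclideanSpace.basisFun (Fin n) ℂ
  -- `L` is the compression of `A` to the span of `v`, and `J` embeds that span isometrically;
  -- Bessel's inequality gives `‖L x‖ ≤ ‖A (J x)‖`.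
  let L : EuclideanSpace ℂ (Fin n) →ₗ[ℂ] EuclideanSpace ℂ (Fin n) :=
    Matrix.toLin b.toBasis b.toBasis M
  let J : EuclideanSpace ℂ (Fin n) →ₗ[ℂ] H := b.toBasis.constr ℂ v
  have hJ : ∀ x, J x = ∑ j, x j • v j := fun x => by
    simp [J, Module.Basis.constr_apply_fintype, b]
  have hJn : ∀ x, ‖J x‖ = ‖x‖ := by
    intro x
    have h1 : ⟪J x, J x⟫_ℂ = ⟪x, x⟫_ℂ := by
      rw [hJ, hv.inner_sum, PiLp.inner_apply]
      exact Finset.sum_congr rfl fun j _ => by rw [RCLike.inner_apply, mul_comm]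
    rw [norm_eq_sqrt_re_inner (𝕜 := ℂ), h1, ← norm_eq_sqrt_re_inner]
  have hL : ∀ x, ‖L x‖ ≤ ‖A (J x)‖ := by
    intro x
    have h1 : ∀ i, L x i = ⟪v i, A (J x)⟫_ℂ := by
      intro i
      have h2 : L x i = ∑ j, M i j * x j := by
        simp [L, Matrix.toLin_apply, b, Matrix.mulVec, dotProduct, Pi.single_apply]
      rw [h2, hJ, map_sum, inner_sum]
      exact Finset.sum_congr rfl fun j _ => by
        rw [map_smul, inner_smul_right, hM, Matrix.of_apply, mul_comm]
    refine le_of_sq_le_sq ?_ (norm_nonneg _)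
    rw [EuclideanSpace.norm_sq_eq]
    simp only [h1]
    exact hv.sum_inner_products_le _
  have hS := L.isSymmetric_adjoint_comp_self
  have hn : Module.finrank ℂ (EuclideanSpace ℂ (Fin n)) = n := by simp
  have hnn := fun i => L.isPositive_adjoint_comp_self.nonneg_eigenvalues hn i
  -- Some combination of the top `i + 1` eigenvectors of `L* L` is killed by `F ∘ J`, where `F` is a
  -- best rank-`i` approximant up to the singular value bound. The product of these eigenvalues is
  -- `‖M.det‖ ^ 2`.
  have hle : ∀ i : Fin n, hS.eigenvalues hn i ≤ singularValue A i ^ 2 := by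
    intro i
    obtain ⟨F, hF, hAF⟩ := hA.exists_rank_le_norm_sub_le i
    let ι : Fin (i.1 + 1) → Fin n := Fin.castLE i.2
    have hu : Orthonormal ℂ fun j => hS.eigenvectorBasis hn (ι j) :=
      (hS.eigenvectorBasis hn).orthonormal.comp _ (Fin.castLE_injective _)
    obtain ⟨c, hc, hFc⟩ := hu.exists_sum_ne_zero_apply_eq_zero ((F : H →ₗ[ℂ] H) ∘ₗ J) 
      ((LinearMap.rank_comp_le_left (J ∘ₗ Fintype.linearCombination ℂ _)
        (F : H →ₗ[ℂ] H)).trans hF)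
    have h1 := hu.mul_norm_sq_le_re_inner (L.adjoint ∘ₗ L)
      (β := fun j => hS.eigenvalues hn (ι j)) (b := hS.eigenvalues hn i)
      (fun j => hS.apply_eigenvectorBasis hn (ι j))
      (fun j => hS.eigenvalues_antitone hn (Nat.lt_succ_iff.1 j.2)) c
    set x := ∑ j, c j • hS.eigenvectorBasis hn (ι j)
    have h2 : RCLike.re ⟪x, (L.adjoint ∘ₗ L) x⟫_ℂ = ‖L x‖ ^ 2 := by
      rw [LinearMap.comp_apply, LinearMap.adjoint_inner_right, inner_self_eq_norm_sq]
    have h3 : A (J x) = (A - F) (J x) := by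
      have : F (J x) = 0 := hFc
      rw [sub_apply, this, sub_zero]
    have h4 : ‖L x‖ ≤ singularValue A i * ‖x‖ := by
      refine (hL x).trans ?_
      rw [h3, ← hJn x]
      exact ((A - F).le_opNorm _).trans (by gcongr)
    rw [h2] at h1
    have h5 : hS.eigenvalues hn i * ‖x‖ ^ 2 ≤ singularValue A i ^ 2 * ‖x‖ ^ 2 := by
      refine h1.trans ?_
      rw [← mul_pow]
      gcongr
    exact le_of_mul_le_mul_right h5 (by have := norm_pos_iff.2 hc; positivity)
  have hdet : ((‖M.det‖ ^ 2 : ℝ) : ℂ) = ((∏ i, hS.eigenvalues hn i : ℝ) : ℂ) := by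
    have h1 := hS.det_eq_prod_eigenvalues hn
    rw [LinearMap.det_comp] at h1
    push_cast
    refine Eq.trans ?_ h1
    have h2 : LinearMap.det L = M.det := LinearMap.det_toLin _ _
    have h3 : LinearMap.det L.adjoint = starRingEnd ℂ M.det := by
      rw [← LinearMap.det_toMatrix b.toBasis, LinearMap.toMatrix_adjoint, LinearMap.toMatrix_toLin,
        Matrix.det_conjTranspose]
      rfl
    rw [h2, h3, mul_comm, Complex.mul_conj, Complex.normSq_eq_norm_sq]
    push_cast; rfl
  refine le_of_sq_le_sq ?_ (Finset.prod_nonneg fun i _ => singularValue_nonneg A i)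
  rw [Complex.ofReal_inj.1 hdet, ← Finset.prod_pow]
  exact Finset.prod_le_prod (fun i _ => hnn i) fun i _ => hle i

/-- **Weyl's inequality**: partial products of the moduli of the eigenvalues are bounded by
partial products of the singular values. -/
theorem IsCompactOperator.prod_norm_eigenvalueSeq_le {A : H →L[ℂ] H} (hA : IsCompactOperator A)
    (n : ℕ) : ∏ i ∈ Finset.range n, ‖eigenvalueSeq A i‖
      ≤ ∏ i ∈ Finset.range n, singularValue A i := by
  have hl := hA.isEigenvalueSeq_eigenvalueSeq
  obtain ⟨e, he⟩ := hl.exists_isTriangularSystem hA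
  by_cases h0 : ∃ i ∈ Finset.range n, eigenvalueSeq A i = 0
  · obtain ⟨i, hi, hi0⟩ := h0
    rw [Finset.prod_eq_zero hi (by rw [hi0, norm_zero])]
    exact Finset.prod_nonneg fun i _ => singularValue_nonneg A i
  push Not at h0
  have hv := he.orthonormal fun i hi => h0 i (Finset.mem_range.2 hi)
  have h1 := hA.norm_det_inner_le_prod_singularValue hv
  have hin : ∀ (i : ℕ) (k : ℕ), k ≤ i → ∀ y ∈ Submodule.span ℂ (e '' Set.Iio k),
      ⟪e i, y⟫_ℂ = 0 := by
    intro i k hki y hy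
    induction hy using Submodule.span_induction with
    | mem y hy =>
      obtain ⟨j, hj, rfl⟩ := hy
      exact he.inner_eq_zero i j (ne_of_gt (lt_of_lt_of_le hj hki))
    | zero => simp
    | add x y _ _ hx hy => rw [inner_add_right, hx, hy, add_zero]
    | smul c x _ hx => rw [inner_smul_right, hx, mul_zero]
  have hentry : ∀ i j, j ≤ i → ⟪e i, A (e j)⟫_ℂ = eigenvalueSeq A j * ⟪e i, e j⟫_ℂ := by
    intro i j hji
    have h2 := hin i j hji _ (he.sub_mem_span j)
    rwa [inner_sub_right, inner_smul_right, sub_eq_zero] at h2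
  -- In a triangular system the matrix of `A` is upper triangular with the eigenvalues on its
  -- diagonal.
  rw [Matrix.det_of_isUpperTriangular, norm_prod] at h1
  · rw [Finset.prod_range, Finset.prod_range]
    refine le_trans (le_of_eq (Finset.prod_congr rfl fun i _ => ?_)) h1
    rw [Matrix.of_apply, hentry i i le_rfl, inner_self_eq_norm_sq_to_K, hv.1 i]
    simp
  · intro i j hij
    rw [Matrix.of_apply, hentry i j (le_of_lt hij), he.inner_eq_zero i j (ne_of_gt hij), mul_zero]

end Weyl

/-! ### Quasi-nilpotence through left eigenvectors. -/

section Quasinilpotent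

variable {H : Type*} [NormedAddCommGroup H] [InnerProductSpace ℂ H] [CompleteSpace H]

/-- A non-zero spectral point of `B` is, conjugated, an eigenvalue of the compact adjoint, and
eigenvectors of the adjoint are left eigenvectors of `B`. -/
theorem isQuasinilpotent_of_forall_inner {B : H →L[ℂ] H} (hB : IsCompactOperator B)
    (h : ∀ (x : H) (c : ℂ), c ≠ 0 → (∀ y, ⟪x, B y⟫_ℂ = c * ⟪x, y⟫_ℂ) → x = 0) :
    IsQuasinilpotent B := by
  intro μ hμ
  by_contra h0
  have h0' : μ ≠ 0 := h0
  have h1 : star μ ∈ spectrum ℂ (star B) := by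
    rw [spectrum.map_star]
    simpa using hμ
  have hs0 : star μ ≠ 0 := star_ne_zero.2 h0'
  obtain ⟨x, hx⟩ := ((hB.adjoint.hasEigenvalue_iff_mem_spectrum hs0).2 h1).exists_hasEigenvector
  refine hx.2 (h x μ h0' fun y => ?_)
  have h2 : B.adjoint x = star μ • x := hx.apply_eq_smul
  rw [← ContinuousLinearMap.adjoint_inner_left, h2, inner_smul_left]
  simp

/-- A left eigenvector of a compact operator that is orthogonal to the generalized eigenspace
vanishes. -/
theorem IsCompactOperator.eq_zero_of_forall_inner_maxGenEigenspace {A : H →L[ℂ] H}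
    (hA : IsCompactOperator A) {z : ℂ} (hz : z ≠ 0) {x : H}
    (hx : ∀ v ∈ Module.End.maxGenEigenspace (A : Module.End ℂ H) z, ⟪x, v⟫_ℂ = 0)
    (hxA : ∀ y, ⟪x, A y⟫_ℂ = z * ⟪x, y⟫_ℂ) : x = 0 := by
  have := hA.finiteDimensional_maxGenEigenspace hz
  set V := Module.End.maxGenEigenspace (A : Module.End ℂ H) z with hV
  set P := V.starProjection
  have hPmem : ∀ y, P y ∈ V := fun y => V.starProjection_apply_mem y
  have hPP : ∀ y, P (P y) = P y := fun y => Submodule.starProjection_eq_self_iff.2 (hPmem y)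
  -- `C` compresses `A` to the complement of `V`. An eigenvector of `C` for `z` would lie in `V`, by
  -- maximality, and also be orthogonal to it. So `z - C` is invertible; solving `(z - C) y = x`
  -- with `y` orthogonal to `V` and pairing with `x` gives `⟪x, x⟫ = 0`.
  let C : H →L[ℂ] H := (1 - P) ∘L A ∘L (1 - P)
  have hC : ∀ y, C y = A (y - P y) - P (A (y - P y)) := fun y => rfl
  have hPC : ∀ y, P (C y) = 0 := fun y => by rw [hC, map_sub, hPP, sub_self]
  have hCc : IsCompactOperator C :=
    (hA.comp_clm (1 - P : H →L[ℂ] H)).clm_comp (1 - P : H →L[ℂ] H)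
  rcases hCc.hasEigenvalue_or_mem_resolventSet hz with h | h
  · exfalso
    obtain ⟨y, hy⟩ := h.exists_hasEigenvector
    have h1 : C y = z • y := hy.apply_eq_smul
    have hPy : P y = 0 := by
      have := hPC y
      rw [h1, map_smul] at this
      exact (smul_eq_zero.1 this).resolve_left hz
    have h2 : A y - z • y ∈ V := by
      have h3 := hC y
      rw [hPy, sub_zero, h1] at h3
      rw [h3, sub_sub_cancel]
      exact hPmem _
    obtain ⟨n, hn⟩ := (Module.End.mem_maxGenEigenspace _ _ _).1 h2
    have h4 : y ∈ V := by
      refine (Module.End.mem_maxGenEigenspace _ _ _).2 ⟨n + 1, ?_⟩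
      rw [pow_succ, Module.End.mul_apply]
      simpa using hn
    exact hy.2 ((Submodule.starProjection_eq_self_iff.2 h4).symm.trans hPy)
  · obtain ⟨y, hy⟩ := (ContinuousLinearMap.isUnit_iff_bijective.1
      (spectrum.mem_resolventSet_iff.1 h)).2 x
    have hy' : z • y - C y = x := by simpa [Algebra.algebraMap_eq_smul_one] using hy
    have hPx : P x = 0 := by
      rw [Submodule.starProjection_apply_eq_zero_iff]
      intro v hv
      rw [← inner_conj_symm, hx v hv, map_zero]
    have hPy : P y = 0 := by
      have := congrArg P hy'
      rw [map_sub, map_smul, hPC, sub_zero, hPx] at this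
      exact (smul_eq_zero.1 this).resolve_left hz
    rw [hC, hPy, sub_zero] at hy'
    refine (inner_self_eq_zero (𝕜 := ℂ)).1 ?_
    nth_rw 2 [← hy']
    rw [inner_sub_right, inner_sub_right, hxA, inner_smul_right, hx _ (hPmem _)]
    ring

end Quasinilpotent

/-! ### Infinite diagonal operators as norm limits. -/

section DiagonalLimit

variable {H : Type*} [NormedAddCommGroup H] [InnerProductSpace ℂ H] [CompleteSpace H]

/-- The compact normal operator with eigenvalues `c` on the orthonormal system `e`. -/
theorem IsOrthonormalOrZero.exists_diagonal {e : ℕ → H} (he : IsOrthonormalOrZero e) {c : ℕ → ℂ}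
    (hc : Antitone fun k => ‖c k‖)
    (hc0 : Filter.Tendsto (fun k => ‖c k‖) Filter.atTop (nhds 0)) :
    ∃ D : H →L[ℂ] H, IsCompactOperator D ∧ IsStarNormal D ∧ (∀ k, D (e k) = c k • e k) ∧
      ∀ x, (∀ k, ⟪e k, x⟫_ℂ = 0) → D x = 0 := by
  let S : ℕ → H →L[ℂ] H := fun n => diagonalSum c e (Finset.range n)
  have hdist : ∀ m n, m ≤ n → ‖S n - S m‖ ≤ ‖c m‖ := by
    intro m n hmn
    have h1 : S n - S m = diagonalSum c e (Finset.Ico m n) := by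
      simp only [S, diagonalSum]
      rw [Finset.sum_Ico_eq_sub _ hmn]
    rw [h1]
    exact he.norm_diagonalSum_le (norm_nonneg _) fun k hk => hc (Finset.mem_Ico.1 hk).1
  have hcau : CauchySeq S := by
    refine cauchySeq_of_le_tendsto_0' (fun k => ‖c k‖) (fun m n hmn => ?_) hc0
    rw [dist_comm, dist_eq_norm]
    exact hdist m n hmn
  obtain ⟨D, hD⟩ := cauchySeq_tendsto_of_complete hcau
  have hDx : ∀ x, Filter.Tendsto (fun n => S n x) Filter.atTop (nhds (D x)) := fun x =>
    ((ContinuousLinearMap.apply ℂ H x).continuous.tendsto D).comp hD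
  have hDadj : ∀ x, Filter.Tendsto (fun n => (S n).adjoint x) Filter.atTop
      (nhds (D.adjoint x)) := fun x =>
    ((ContinuousLinearMap.apply ℂ H x).continuous.tendsto _).comp
      (((ContinuousLinearMap.adjoint (𝕜 := ℂ) (E := H) (F := H)).continuous.tendsto D).comp hD)
  refine ⟨D, ?_, ?_, fun k => ?_, fun x hx => ?_⟩
  · exact isCompactOperator_of_tendsto hD (Filter.Eventually.of_forall fun n =>
      isCompactOperator_of_rank_lt_aleph0 _
        ((rank_diagonalSum_le _ _ _).trans_lt Cardinal.natCast_lt_aleph0))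
  · rw [ContinuousLinearMap.isStarNormal_iff_norm_eq_adjoint]
    intro x
    refine tendsto_nhds_unique (hDx x).norm ((hDadj x).norm.congr fun n => ?_)
    exact (ContinuousLinearMap.isStarNormal_iff_norm_eq_adjoint.1
      (he.isStarNormal_diagonalSum c (Finset.range n)) x).symm
  · refine tendsto_nhds_unique (hDx (e k)) (tendsto_const_nhds.congr' ?_)
    filter_upwards [Filter.eventually_gt_atTop k] with n hn
    simp only [S]
    rw [diagonalSum_apply, Finset.sum_eq_single_of_mem k (Finset.mem_range.2 hn) fun j _ hj => by
      rw [he.inner_eq_zero j k hj, mul_zero, zero_smul]]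
    rcases he.eq_zero_or_norm k with h | h
    · simp [h]
    · simp [inner_self_eq_norm_sq_to_K, h]
  · refine tendsto_nhds_unique (hDx x) (tendsto_const_nhds.congr fun n => ?_)
    simp only [S]
    rw [diagonalSum_apply]
    exact (Finset.sum_eq_zero fun k _ => by rw [hx k, mul_zero, zero_smul]).symm

end DiagonalLimit

/-! ### Existence of Schur decompositions. -/

section SchurDecomposition

variable {H : Type*} [NormedAddCommGroup H] [InnerProductSpace ℂ H] [CompleteSpace H]

/-- The generalized eigenspace at `z` is the span of the `e k` with `c k = z`: after subtracting
that projection, the remainder is killed by `D`, and generalized eigenspaces at `z` and at 0 are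
disjoint. -/
theorem algMultiplicity_diagonal {D : H →L[ℂ] H} {e : ℕ → H} {c : ℕ → ℂ}
    (he : IsOrthonormalOrZero e) (hn : IsStarNormal D) (hD : ∀ k, D (e k) = c k • e k)
    (hD0 : ∀ x, (∀ k, ⟪e k, x⟫_ℂ = 0) → D x = 0) {z : ℂ} (hz : z ≠ 0) {m : ℕ}
    (hne : ∀ k, c k = z → e k ≠ 0) (hm : {k | c k = z}.encard = (m : ℕ∞)) :
    algMultiplicity D z = m := by
  have hfin : {k | c k = z}.Finite := Set.finite_of_encard_eq_coe hm
  have hort : Orthonormal ℂ fun k : hfin.toFinset => e k :=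
    ⟨fun k => (he.eq_zero_or_norm k).resolve_left (hne k (hfin.mem_toFinset.1 k.2)),
      fun j k hjk => he.inner_eq_zero _ _ fun h => hjk (Subtype.ext h)⟩
  have hpow : ∀ k n x, ⟪e k, (((D : Module.End ℂ H) - z • (1 : Module.End ℂ H)) ^ n) x⟫_ℂ
      = (c k - z) ^ n * ⟪e k, x⟫_ℂ := by
    intro k n
    induction n with
    | zero => intro x; simp
    | succ n ih =>
      intro x
      have h1 : ((D : Module.End ℂ H) - z • (1 : Module.End ℂ H)) x = D x - z • x := by simp
      rw [pow_succ, Module.End.mul_apply, h1, ih, inner_sub_right,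
        inner_apply_of_isStarNormal hn (hD k), inner_smul_right]
      ring
  have hmemV : ∀ k, c k = z → e k ∈ Module.End.maxGenEigenspace (D : Module.End ℂ H) z :=
    fun k hk => Module.End.eigenspace_le_maxGenEigenspace
      (Module.End.mem_eigenspace_iff.2 ((hD k).trans (by rw [hk])))
  have hV : Module.End.maxGenEigenspace (D : Module.End ℂ H) z
      = Submodule.span ℂ (Set.range fun k : hfin.toFinset => e k) := by
    refine le_antisymm (fun x hx => ?_) (Submodule.span_le.2 ?_)
    · obtain ⟨n, hn'⟩ := (Module.End.mem_maxGenEigenspace _ _ _).1 hx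
      have hker : ∀ k, c k ≠ z → ⟪e k, x⟫_ℂ = 0 := fun k hk => by
        have := hpow k n x
        rw [hn', inner_zero_right, eq_comm, mul_eq_zero] at this
        exact this.resolve_left (pow_ne_zero _ (sub_ne_zero.2 hk))
      set p := diagonalSum 1 e hfin.toFinset x with hp
      have hpx : ∀ k, ⟪e k, x - p⟫_ℂ = 0 := fun k => by
        rw [inner_sub_right, hp, he.inner_diagonalSum]
        by_cases hk : c k = z
        · rw [if_pos (by simpa using hk)]; simp
        · rw [if_neg (by simpa using hk), hker k hk, sub_zero]
      have hpmem : p ∈ Submodule.span ℂ (Set.range fun k : hfin.toFinset => e k) := by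
        rw [hp, diagonalSum_apply]
        exact Submodule.sum_mem _ fun k hk =>
          Submodule.smul_mem _ _ (Submodule.subset_span ⟨⟨k, hk⟩, rfl⟩)
      have hpV : p ∈ Module.End.maxGenEigenspace (D : Module.End ℂ H) z := by
        rw [hp, diagonalSum_apply]
        exact Submodule.sum_mem _ fun k hk =>
          Submodule.smul_mem _ _ (hmemV k (by simpa using hk))
      have h0 : x - p ∈ Module.End.maxGenEigenspace (D : Module.End ℂ H) 0 :=
        Module.End.eigenspace_le_maxGenEigenspace (Module.End.mem_eigenspace_iff.2
          ((hD0 _ hpx).trans (zero_smul _ _).symm))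
      have hdisj := (Module.End.independent_maxGenEigenspace
        (D : Module.End ℂ H)).pairwiseDisjoint hz
      have := Submodule.disjoint_def.1 hdisj _ (Submodule.sub_mem _ hx hpV) h0
      rwa [sub_eq_zero.1 this]
    · rintro _ ⟨k, rfl⟩
      exact hmemV k (hfin.mem_toFinset.1 k.2)
  rw [algMultiplicity, hV, finrank_span_eq_card hort.linearIndependent, Fintype.card_coe]
  rw [hfin.encard_eq_coe_toFinset_card] at hm
  exact_mod_cast hm

/-- Treats both quasi-nilpotence conditions at once: `R = 1`, `w = 1` for `N`, and `R` the resolvent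
of `D` at `w` for the other. The condition `hw` says that `R` acts as `1 / w` on the left of vectors
orthogonal to the system. -/
theorem IsTriangularSystem.isQuasinilpotent_mul {A D R : H →L[ℂ] H} {l : ℕ → ℂ} {e : ℕ → H}
    (hA : IsCompactOperator A) (he : IsTriangularSystem A l e) (hDc : IsCompactOperator D)
    (hDn : IsStarNormal D) (hD : ∀ k, D (e k) = l k • e k)
    (hD0 : ∀ x, (∀ k, ⟪e k, x⟫_ℂ = 0) → D x = 0) (hR : ∀ k, ∃ ρ : ℂ, R (e k) = ρ • e k)
    {w : ℂ} (hw : ∀ x, (∀ k, ⟪e k, x⟫_ℂ = 0) → ∀ y, w * ⟪x, R y⟫_ℂ = ⟪x, y⟫_ℂ) :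
    IsQuasinilpotent (R * (A - D)) := by
  refine isQuasinilpotent_of_forall_inner ((hA.sub hDc).clm_comp R) fun x c hc hx => ?_
  replace hx : ∀ y, ⟪x, R (A y - D y)⟫_ℂ = c * ⟪x, y⟫_ℂ := hx
  have hort : ∀ k, ⟪x, e k⟫_ℂ = 0 := by
    intro k
    induction k using Nat.strong_induction_on with
    | _ k ih =>
      have h1 : ∀ y ∈ Submodule.span ℂ (e '' Set.Iio k), ⟪x, R y⟫_ℂ = 0 := by
        intro y hy
        induction hy using Submodule.span_induction with
        | mem y hy =>
          obtain ⟨j, hj, rfl⟩ := hy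
          obtain ⟨ρ, hρ⟩ := hR j
          rw [hρ, inner_smul_right, ih j hj, mul_zero]
        | zero => simp
        | add x y _ _ hx hy => rw [map_add, inner_add_right, hx, hy, add_zero]
        | smul c x _ hx => rw [map_smul, inner_smul_right, hx, mul_zero]
      have h2 := hx (e k)
      rw [hD, h1 _ (he.sub_mem_span k), eq_comm, mul_eq_zero] at h2
      exact h2.resolve_left hc
  have hort' : ∀ k, ⟪e k, x⟫_ℂ = 0 := fun k => by rw [← inner_conj_symm, hort, map_zero]
  have hxD : ∀ y, ⟪x, D y⟫_ℂ = 0 := fun y => by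
    rw [inner_apply_of_isStarNormal hDn (z := 0) (by rw [hD0 x hort', zero_smul]), zero_mul]
  -- Away from the system `D` contributes nothing, so `x` is a left eigenvector of `A` itself, with
  -- eigenvalue `w * c`.
  have hxA : ∀ y, ⟪x, A y⟫_ℂ = (w * c) * ⟪x, y⟫_ℂ := fun y => by
    have h3 := hw x hort' (A y - D y)
    rw [hx, inner_sub_right, hxD, sub_zero] at h3
    rw [← h3, mul_assoc]
  by_cases hw0 : w = 0
  · have := hw x hort' x
    rw [hw0, zero_mul] at this
    exact inner_self_eq_zero.1 this.symm
  · refine hA.eq_zero_of_forall_inner_maxGenEigenspace (mul_ne_zero hw0 hc) (fun v hv => ?_) hxA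
    have hmem := he.maxGenEigenspace_le _ (mul_ne_zero hw0 hc) hv
    clear hv
    induction hmem using Submodule.span_induction with
    | mem y hy => obtain ⟨j, rfl⟩ := hy; exact hort j
    | zero => simp
    | add x y _ _ hx hy => rw [inner_add_right, hx, hy, add_zero]
    | smul c x _ hx => rw [inner_smul_right, hx, mul_zero]

/-- Every compact operator on a Hilbert space has a Schur decomposition. -/
theorem IsCompactOperator.exists_isSchurDecomposition {A : H →L[ℂ] H} (hA : IsCompactOperator A) :
    ∃ D N : H →L[ℂ] H, IsSchurDecomposition A D N := by
  have hl := hA.isEigenvalueSeq_eigenvalueSeq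
  obtain ⟨e, he⟩ := hl.exists_isTriangularSystem hA
  set l := eigenvalueSeq A
  have ho := he.isOrthonormalOrZero
  obtain ⟨D, hDc, hDn, hD, hD0⟩ := ho.exists_diagonal hl.1 (hl.tendsto_zero hA)
  refine ⟨D, A - D, ⟨by abel, hDc, hA.sub hDc, hDn, ?_, ?_, fun w hw => ?_⟩⟩
  · refine eigenvalueSeq_congr fun z hz => ?_
    refine algMultiplicity_diagonal ho hDn hD hD0 hz (fun k hk h0 => ?_) (hl.2 z hz)
    have := he.norm_eq_one k (by rw [hk]; exact hz)
    rw [h0, norm_zero] at this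
    exact zero_ne_one this
  · rw [← one_mul (A - D)]
    exact he.isQuasinilpotent_mul hA hDc hDn hD hD0 (fun k => ⟨1, by simp⟩) (w := 1)
      (fun x _ y => by simp)
  · have hu := spectrum.mem_resolventSet_iff.1 hw
    have h1 : ∀ y, w • resolvent D w y - D (resolvent D w y) = y := fun y => by
      have := congrArg (fun T : H →L[ℂ] H => T y) (Ring.mul_inverse_cancel _ hu)
      simpa [resolvent, Algebra.algebraMap_eq_smul_one] using this
    have h2 : ∀ y, resolvent D w (w • y - D y) = y := fun y => by
      have := congrArg (fun T : H →L[ℂ] H => T y) (Ring.inverse_mul_cancel _ hu)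
      simpa [resolvent, Algebra.algebraMap_eq_smul_one] using this
    refine he.isQuasinilpotent_mul hA hDc hDn hD hD0 (w := w) (fun k => ?_) fun x hx y => ?_
    · have h3 := h2 (e k)
      rw [hD, ← sub_smul, map_smul] at h3
      -- If `w = l k`, then `h3` forces `e k = 0`, and any factor would do.
      by_cases h0 : w - l k = 0
      · rw [h0, zero_smul] at h3
        exact ⟨0, by rw [← h3]; simp⟩
      · exact ⟨(w - l k)⁻¹, by rw [eq_inv_smul_iff₀ h0, h3]⟩
    · nth_rw 2 [← h1 y]
      rw [inner_sub_right, inner_smul_right,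
        inner_apply_of_isStarNormal hDn (z := 0) (by rw [hD0 x hx, zero_smul])]
      ring

end SchurDecomposition

/-! ### Geometric means and the final estimates. -/

theorem le_geomMeans {w : ℕ → ℝ} {x : ℝ} (hx : 0 ≤ x) {k : ℕ}
    (h : x ^ (k + 1) ≤ ∏ i ∈ Finset.range (k + 1), w i) : x ≤ geomMeans w k := by
  have hk : ((k : ℝ) + 1) ≠ 0 := by positivity
  have h1 := Real.rpow_le_rpow (z := 1 / ((k : ℝ) + 1)) (by positivity) h (by positivity)
  rwa [← Real.rpow_natCast, ← Real.rpow_mul hx, Nat.cast_add, Nat.cast_one, mul_one_div_cancel hk,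
    Real.rpow_one] at h1

theorem le_mul_geomMeans {w : ℕ → ℝ} {x M : ℝ} (hx : 0 ≤ x) (hM : 0 ≤ M) {k : ℕ}
    (h : x ^ (k + 1) ≤ ∏ i ∈ Finset.range (k + 1), (M * w i)) : x ≤ M * geomMeans w k := by
  rcases hM.eq_or_lt with rfl | hM
  · simp only [zero_mul, Finset.prod_const, Finset.card_range] at h ⊢
    rw [zero_pow (Nat.succ_ne_zero k)] at h
    exact (pow_eq_zero_iff (Nat.succ_ne_zero k)).1 (le_antisymm h (by positivity)) |>.le
  · rw [← div_le_iff₀' hM]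
    refine le_geomMeans (by positivity) ?_
    rw [div_pow, div_le_iff₀' (by positivity)]
    simpa [Finset.prod_mul_distrib] using h

theorem IsWeight.le_geomMeans_self {w : ℕ → ℝ} (hw : IsWeight w) (k : ℕ) : w k ≤ geomMeans w k := by
  refine le_geomMeans (hw.nonneg k) ?_
  calc w k ^ (k + 1) = ∏ _i ∈ Finset.range (k + 1), w k := by simp
    _ ≤ _ := Finset.prod_le_prod (fun _ _ => hw.nonneg k) fun i hi =>
      hw.antitone (Nat.lt_succ_iff.1 (Finset.mem_range.1 hi))

section

variable {H : Type*} [NormedAddCommGroup H] [InnerProductSpace ℂ H] [CompleteSpace H]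

theorem IsCompactOperator.norm_eigenvalueSeq_le_mul_geomMeans {A : H →L[ℂ] H}
    (hA : IsCompactOperator A) {w : ℕ → ℝ} {M : ℝ} (hM : 0 ≤ M)
    (hAM : ∀ k, singularValue A k ≤ M * w k) (k : ℕ) :
    ‖eigenvalueSeq A k‖ ≤ M * geomMeans w k := by
  refine le_mul_geomMeans (norm_nonneg _) hM ?_
  calc ‖eigenvalueSeq A k‖ ^ (k + 1)
      = ∏ _i ∈ Finset.range (k + 1), ‖eigenvalueSeq A k‖ := by simp
    _ ≤ ∏ i ∈ Finset.range (k + 1), ‖eigenvalueSeq A i‖ :=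
      Finset.prod_le_prod (fun _ _ => norm_nonneg _) fun i hi =>
        hA.isEigenvalueSeq_eigenvalueSeq.1 (Nat.lt_succ_iff.1 (Finset.mem_range.1 hi))
    _ ≤ ∏ i ∈ Finset.range (k + 1), singularValue A i := hA.prod_norm_eigenvalueSeq_le _
    _ ≤ _ := Finset.prod_le_prod (fun i _ => singularValue_nonneg A i) fun i _ => hAM i

theorem IsSchurDecomposition.singularValue_normalPart_le {A D N : H →L[ℂ] H}
    (hS : IsSchurDecomposition A D N) (hA : IsCompactOperator A) {w : ℕ → ℝ}
    {M : ℝ} (hM : 0 ≤ M) (hAM : ∀ k, singularValue A k ≤ M * w k) (k : ℕ) :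
    singularValue D k ≤ M * geomMeans w k := by
  refine (singularValue_le_norm_of_isStarNormal hS.normal hS.compact_normalPart k).trans ?_
  rw [hS.eigenvalueSeq_eq]
  exact hA.norm_eigenvalueSeq_le_mul_geomMeans hM hAM k

/-- Best approximants of ranks `i` and `j` differ by an operator of rank at most `i + j`. -/
theorem singularValue_sub_le {A B : H →L[ℂ] H} (hA : IsCompactOperator A)
    (hB : IsCompactOperator B) {i j k : ℕ} (h : i + j ≤ k) :
    singularValue (A - B) k ≤ singularValue A i + singularValue B j := by
  obtain ⟨F, hF, hAF⟩ := hA.exists_rank_le_norm_sub_le i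
  obtain ⟨G, hG, hBG⟩ := hB.exists_rank_le_norm_sub_le j
  have hrank : ((F - G : H →L[ℂ] H) : H →ₗ[ℂ] H).rank ≤ (k : Cardinal) := by
    have h1 : ((F - G : H →L[ℂ] H) : H →ₗ[ℂ] H)
        = (F : H →ₗ[ℂ] H) + (-1 : H →ₗ[ℂ] H) ∘ₗ (G : H →ₗ[ℂ] H) := by
      ext x; simp [sub_eq_add_neg]
    rw [h1]
    calc _ ≤ _ := LinearMap.rank_add_le _ _
      _ ≤ (i : Cardinal) + (j : Cardinal) :=
        add_le_add hF ((LinearMap.rank_comp_le_right _ _).trans hG)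
      _ ≤ _ := by exact_mod_cast h
  refine ((hA.sub hB).singularValue_le_norm_sub hrank).trans ?_
  have h2 : A - B - (F - G) = (A - F) - (B - G) := by abel
  rw [h2]
  exact (norm_sub_le _ _).trans (add_le_add hAF hBG)

theorem IsSchurDecomposition.singularValue_nilpotentPart_le {A D N : H →L[ℂ] H}
    (hS : IsSchurDecomposition A D N) (hA : IsCompactOperator A) {w : ℕ → ℝ} (hw : IsWeight w)
    {M : ℝ} (hM : 0 ≤ M) (hAM : ∀ k, singularValue A k ≤ M * w k) (k : ℕ) :
    singularValue N k ≤ (2 * M) * doubled (geomMeans w) k := by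
  have hN : N = A - D := by rw [hS.eq_add, add_sub_cancel_left]
  rw [hN]
  refine (singularValue_sub_le hA hS.compact_normalPart (i := k / 2) (j := k / 2)
    (by omega)).trans ?_
  have h1 := (hAM (k / 2)).trans (mul_le_mul_of_nonneg_left (hw.le_geomMeans_self (k / 2)) hM)
  have h2 := hS.singularValue_normalPart_le hA hM hAM (k / 2)
  rw [doubled]
  linarith

theorem gauge_w_nonneg (w : ℕ → ℝ) (A : H →L[ℂ] H) : 0 ≤ gauge_w w A :=
  Real.sInf_nonneg fun _ h => h.1

theorem gauge_w_le {w : ℕ → ℝ} {A : H →L[ℂ] H} {M : ℝ} (hM : 0 ≤ M)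
    (h : ∀ k, singularValue A k ≤ M * w k) : gauge_w w A ≤ M :=
  csInf_le ⟨0, fun _ h => h.1⟩ ⟨hM, h⟩

/-- Lets bounds valid for every admissible `M` pass to the gauge without showing that the infimum is
attained. -/
theorem le_gauge_w {w : ℕ → ℝ} {A : H →L[ℂ] H} (hA : A ∈ compactnessClass w) {r : ℝ}
    (h : ∀ M, 0 ≤ M → (∀ k, singularValue A k ≤ M * w k) → r ≤ M) : r ≤ gauge_w w A := by
  obtain ⟨-, M, hM, hAM⟩ := hA
  exact le_csInf ⟨M, hM, hAM⟩ fun M hM => h M hM.1 hM.2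

theorem IsSchurDecomposition.gauge_nilpotentPart_le {A D N : H →L[ℂ] H}
    (hS : IsSchurDecomposition A D N) {w : ℕ → ℝ} (hw : IsWeight w) (hA : A ∈ compactnessClass w) :
    gauge_w (doubled (geomMeans w)) N ≤ 2 * gauge_w w A := by
  -- The gauge is halved because each admissible `M` for `A` yields the constant `2 * M` for `N`.
  have h := le_gauge_w hA (r := gauge_w (doubled (geomMeans w)) N / 2) fun M hM hAM => by
    have := gauge_w_le (by positivity) (hS.singularValue_nilpotentPart_le hA.1 hw hM hAM)
    linarith
  linarith

end

theorem proposition4p6 {H : Type*} [NormedAddCommGroup H] [InnerProductSpace ℂ H]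
    [CompleteSpace H] [TopologicalSpace.SeparableSpace H]
    (w : ℕ → ℝ) (hw : IsWeight w) (A : H →L[ℂ] H) (hA : A ∈ compactnessClass w) :
    (∀ D N : H →L[ℂ] H, IsSchurDecomposition A D N →
      (D ∈ compactnessClass (geomMeans w) ∧ gauge_w (geomMeans w) D ≤ gauge_w w A) ∧
      (N ∈ compactnessClass (doubled (geomMeans w)) ∧
        gauge_w (doubled (geomMeans w)) N ≤ 2 * gauge_w w A)) ∧
    (∃ D N : H →L[ℂ] H, IsSchurDecomposition A D N) ∧
    departure w A ≤ 2 * gauge_w w A := by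
  obtain ⟨hAc, M, hM, hAM⟩ := hA
  refine ⟨fun D N hS => ⟨⟨?_, ?_⟩, ?_, hS.gauge_nilpotentPart_le hw ⟨hAc, M, hM, hAM⟩⟩,
    hAc.exists_isSchurDecomposition, ?_⟩
  · exact ⟨hS.compact_normalPart, M, hM, hS.singularValue_normalPart_le hAc hM hAM⟩
  · exact le_gauge_w ⟨hAc, M, hM, hAM⟩ fun M hM hAM =>
      gauge_w_le hM (hS.singularValue_normalPart_le hAc hM hAM)
  · exact ⟨hS.compact_nilpotentPart, 2 * M, by positivity,
      hS.singularValue_nilpotentPart_le hAc hw hM hAM⟩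
  · obtain ⟨D, N, hS⟩ := hAc.exists_isSchurDecomposition
    have hle : departure w A ≤ gauge_w (doubled (geomMeans w)) N := by
      refine csInf_le ⟨0, ?_⟩ ⟨D, N, hS, rfl⟩
      rintro _ ⟨D', N', -, rfl⟩
      exact gauge_w_nonneg _ _
    exact hle.trans (hS.gauge_nilpotentPart_le hw ⟨hAc, M, hM, hAM⟩)
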